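/- **LS+DREM observer with full input measurement.** *Generator.* Let $\omega_0,H,D,T'_{d0},T'_{q0},X_d,X'_d,X_q,X'_q>0$ and $R\ge 0$, and put $a_0=\frac{D\omega_0}{2H}$, $a_1=\frac1{T'_{d0}}$, $a_2=\frac1{T'_{q0}}$, $b_0=\frac{\omega_0}{2H}$, $b_1=\frac{X_d-X'_d}{T'_{d0}}$, $b_2=\frac{X_q-X'_q}{T'_{q0}}$, $b_3=\frac{\omega_0R}{2H}$. Let $x=(x_1,\dots,x_4)$ be a bounded solution on $[0,\infty)$ of $$\dot x_1=x_2,\qquad \dot x_2=-a_0x_2+b_0(u_1-y_5)-b_3y_4^2,$$ $$\dot x_3=-a_1x_3-\tfrac{b_1}{y_2}\big(\sin(x_1-y_1)y_5+\cos(x_1-y_1)y_6\big)+a_1u_2,$$ $$\dot x_4=-a_2x_4+\tfrac{b_2}{y_2}\big(\cos(x_1-y_1)y_5-\sin(x_1-y_1)y_6\big)$$ with inputs $u_1,u_2$ and measurements $y_1,\dots,y_6$, $y_2>0$, such that at each time there are currents $I_q,I_d$ with $$V_q:=y_2\cos(x_1-y_1)=x_3-RI_q-X'_dI_d,\qquad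 V_d:=y_2\sin(x_1-y_1)=x_4+X'_qI_q-RI_d,$$ $$y_4^2=I_q^2+I_d^2,\qquad y_5=V_qI_q+V_dI_d,\qquad y_6=V_qI_d-V_dI_q.$$ Let $\dot v_1=v_2$, $\dot v_2=-a_0v_2+b_0(u_1-y_5)-b_3y_4^2$, $v(0)=0$. Put $\theta_0:=x_1(0)+x_2(0)/a_0$ (so $x_1-v_1-\theta_0\to0$ exponentially fast, and $x_1=v_1+\theta_0$ exactly if $x_2(0)=0$), $(\theta_1,\theta_2):=(\sin\theta_0,\cos\theta_0)$, and $$W(v,y)=\frac1{y_2}\begin{bmatrix}-Ry_6+X'_dy_5& Ry_5+X'_dy_6+y_2^2\\ Ry_5+X'_qy_6+y_2^2& Ry_6-X'_qy_5\end{bmatrix}\begin{bmatrix}\cos(v_1-y_1)&\sin(v_1-y_1)\\-\sin(v_1-y_1)&\cos(v_1-y_1)\end{bmatrix}.$$ *Regression.* Let $\mathcal Y=y_4^2$, $\mathcal G_0(\theta_1,\theta_2)=(\theta_1,\theta_2,\theta_1^2,\theta_2^2,\theta_1\theta_2)^\top$, and let $\psi:[0,\infty)\to\mathbb R^5$ be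 a continuous bounded signal with $\mathcal Y=\psi^\top\mathcal G_0(\theta_1,\theta_2)$ for all $t\ge0$ which is interval exciting: $\int_0^{t_c}\psi\psi^\top ds>\delta I_5$ for some $t_c,\delta>0$. *Estimator.* Let $\gamma_{\mathcal G},\gamma_1,\gamma_2,f_0,\chi_0>0$, $k\ge1/f_0$, and let $\hat{\mathcal G}_0,F,\hat\theta_1,\hat\theta_2,z$ be a solution on $[0,\infty)$, with arbitrary $\hat{\mathcal G}_0(0)\in\mathbb R^5$, $\hat\theta_1(0)\in\mathbb R$, of $$\dot{\hat{\mathcal G}}_0=\gamma_{\mathcal G}F\psi(\mathcal Y-\psi^\top\hat{\mathcal G}_0),\quad \dot F=-\gamma_{\mathcal G}F\psi\psi^\top F+\chi F,\ F(0)=\tfrac1{f_0}I_5,\quad \dot z=-\chi z,\ z(0)=1,$$ $$\dot{\hat\theta}_i=\gamma_i\Delta(\mathbf Y_i-\Delta\hat\theta_i)\ (i=1,2),\quad \chi=\chi_0\Big(1-\frac{\|F\|}{k}\Big),$$ $$\Delta=\det(I_5-zf_0F),\qquad \mathbf Y=\mathrm{adj}(I_5-zf_0F)\big(\hat{\mathcal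 G}_0-zf_0F\hat{\mathcal G}_0(0)\big),$$ where $\|\cdot\|$ is the matrix norm induced by the Euclidean norm. Assume that a constant $\theta_2^a>0$ and a sign $\sigma\in\{1,-1\}$ are known such that $\sigma\cos\theta_0\ge\theta_2^a$, and that $\sigma\hat\theta_2(0)\ge\theta_2^a$. Then: (i) $(\hat\theta_1,\hat\theta_2)\to(\theta_1,\theta_2)$ exponentially fast. (ii) $\sigma\hat\theta_2(t)\ge\theta_2^a$ for all $t\ge0$; in particular $\hat\theta_2$ is bounded away from zero. (iii) Let $\hat x_1=v_1+\arctan(\hat\theta_1/\hat\theta_2)$, $\hat x_2=v_2$, $(\hat x_3,\hat x_4)^\top=W(v,y)(\hat\theta_1,\hat\theta_2)^\top$. Then $\hat x_i-x_i\to0$ exponentially fast for $i=2,3,4$, and $\hat x_1+m\pi-x_1\to0$ exponentially fast, where $m$ is the integer with $|\theta_0-m\pi|<\pi/2$; it is even if and only if $\sigma=1$. Thus if $\sigma=1$ the rotor angle estimate $\hat x_1$ converges to $x_1$ as an angle (modulo $2\pi$), and even $\hat x_1-x_1\to0$ if $|\theta_0|<\pi/2$; if $\sigma=-1$ it converges to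 $x_1+\pi$ modulo $2\pi$. (iv) The signals $v,\hat{\mathcal G}_0,F,\hat\theta_1,\hat\theta_2,z,\chi,\Delta,\mathbf Y,W(v,y),\hat x$ are bounded on $[0,\infty)$. Here "exponentially fast" means bounded in absolute value by $Ce^{-\alpha t}$ for all $t\ge0$, for some $C,\alpha>0$. -/

import Mathlib

open Set

noncomputable section

namespace SGObserver

/-! ### Signals on `[0, ∞)` -/

/-- `f' = g` on `[0, ∞)` (one-sided derivative at `0`). -/
def HasRate (f g : ℝ → ℝ) : Prop :=
  ∀ t, 0 ≤ t → HasDerivWithinAt f (g t) (Ici 0) t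

/-- The signal `f` is bounded on `[0, ∞)`. -/
def BddSignal (f : ℝ → ℝ) : Prop :=
  ∃ C : ℝ, ∀ t, 0 ≤ t → |f t| ≤ C

/-- The signal `f` converges to zero exponentially fast. -/
def ExpToZero (f : ℝ → ℝ) : Prop :=
  ∃ C α : ℝ, 0 < C ∧ 0 < α ∧ ∀ t, 0 ≤ t → |f t| ≤ C * Real.exp (-α * t)

/-! ### The synchronous generator and its measurements -/

/-- Constants of the two-axis fourth-order synchronous generator model.  A lossless stator
(`R = 0`) is allowed. -/
structure Params where
  ω₀ : ℝ
  H : ℝ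
  D : ℝ
  Td0' : ℝ
  Tq0' : ℝ
  Xd : ℝ
  Xd' : ℝ
  Xq : ℝ
  Xq' : ℝ
  R : ℝ
  ω₀_pos : 0 < ω₀
  H_pos : 0 < H
  D_pos : 0 < D
  Td0'_pos : 0 < Td0'
  Tq0'_pos : 0 < Tq0'
  Xd_pos : 0 < Xd
  Xd'_pos : 0 < Xd'
  Xq_pos : 0 < Xq
  Xq'_pos : 0 < Xq'
  R_nonneg : 0 ≤ R

namespace Params
variable (p : Params)
def a0 : ℝ := p.D * p.ω₀ / (2 * p.H)
def a1 : ℝ := 1 / p.Td0'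
def a2 : ℝ := 1 / p.Tq0'
def b0 : ℝ := p.ω₀ / (2 * p.H)
def b1 : ℝ := 1 / p.Td0' * (p.Xd - p.Xd')
def b2 : ℝ := 1 / p.Tq0' * (p.Xq - p.Xq')
def b3 : ℝ := p.ω₀ * p.R / (2 * p.H)
end Params

/-- One PMU reading `y`: terminal voltage angle `y₁` and magnitude `y₂`, terminal current angle
`y₃` and magnitude `y₄`, active power `y₅` and reactive power `y₆`. -/
structure PMU where
  y₁ : ℝ
  y₂ : ℝ
  y₃ : ℝ
  y₄ : ℝ
  y₅ : ℝ
  y₆ : ℝ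

/-- The algebraic relations between the state `x = (δ, ω, E_q', E_d')` and the reading `y`: there
are axis currents `I_q`, `I_d` satisfying the stator equations, with current magnitude `y₄`,
active power `y₅ = V_q I_q + V_d I_d` and reactive power `y₆ = V_q I_d - V_d I_q`, where
`V_q = y₂ cos (x₁ - y₁)`, `V_d = y₂ sin (x₁ - y₁)`. -/
def TerminalRelations (p : Params) (x : Fin 4 → ℝ) (y : PMU) : Prop :=
  0 < y.y₂ ∧ ∃ Iq Id : ℝ,
    y.y₂ * Real.cos (x 0 - y.y₁) = x 2 - (p.R * Iq + p.Xd' * Id) ∧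
    y.y₂ * Real.sin (x 0 - y.y₁) = x 3 - (-p.Xq' * Iq + p.R * Id) ∧
    y.y₄ ^ 2 = Iq ^ 2 + Id ^ 2 ∧
    y.y₅ = y.y₂ * Real.cos (x 0 - y.y₁) * Iq + y.y₂ * Real.sin (x 0 - y.y₁) * Id ∧
    y.y₆ = y.y₂ * Real.cos (x 0 - y.y₁) * Id - y.y₂ * Real.sin (x 0 - y.y₁) * Iq

/-- `x` is a trajectory of the generator with input `u = (P_m, E_f)` and measurement `y`. -/
structure IsGenerator (p : Params) (u : ℝ → Fin 2 → ℝ) (y : ℝ → PMU) (x : ℝ → Fin 4 → ℝ) :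
    Prop where
  terminal : ∀ t, 0 ≤ t → TerminalRelations p (x t) (y t)
  dx₁ : HasRate (fun t => x t 0) (fun t => x t 1)
  dx₂ : HasRate (fun t => x t 1) (fun t =>
    -p.a0 * x t 1 + p.b0 * (u t 0 - (y t).y₅) - p.b3 * (y t).y₄ ^ 2)
  dx₃ : HasRate (fun t => x t 2) (fun t =>
    -p.a1 * x t 2 - p.b1 / (y t).y₂ * (Real.sin (x t 0 - (y t).y₁) * (y t).y₅
      + Real.cos (x t 0 - (y t).y₁) * (y t).y₆) + p.a1 * u t 1)
  dx₄ : HasRate (fun t => x t 3) (fun t =>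
    -p.a2 * x t 3 + p.b2 / (y t).y₂ * (Real.cos (x t 0 - (y t).y₁) * (y t).y₅
      - Real.sin (x t 0 - (y t).y₁) * (y t).y₆))

/-! ### The observer -/

/-- The dynamic extension `v = (v₁, v₂)`. -/
structure IsExtension (p : Params) (u : ℝ → Fin 2 → ℝ) (y : ℝ → PMU) (v : ℝ → Fin 2 → ℝ) :
    Prop where
  init : v 0 = 0
  dv₁ : HasRate (fun t => v t 0) (fun t => v t 1)
  dv₂ : HasRate (fun t => v t 1) (fun t =>
    -p.a0 * v t 1 + p.b0 * (u t 0 - (y t).y₅) - p.b3 * (y t).y₄ ^ 2)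

/-- The constant `θ₀` with `x₁ = v₁ + θ₀` up to an exponentially decaying term:
`x₁ - v₁ = x₁(0) + x₂(0) ∫₀ᵗ e^{-a₀ τ} dτ`, whose limit is `x₁(0) + x₂(0) / a₀`
(just `x₁(0)` if `x₂(0) = 0`). -/
def θ₀ (p : Params) (x : ℝ → Fin 4 → ℝ) : ℝ := x 0 0 + x 0 1 / p.a0

/-- `e^{-𝒥 a}` for `𝒥 = [0, -1; 1, 0]`. -/
def rot (a : ℝ) : Matrix (Fin 2) (Fin 2) ℝ :=
  !![Real.cos a, Real.sin a; -Real.sin a, Real.cos a]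

/-- The matrix `W(v, y)`. -/
def W (p : Params) (v : Fin 2 → ℝ) (y : PMU) : Matrix (Fin 2) (Fin 2) ℝ :=
  (1 / y.y₂) •
    (!![-p.R * y.y₆ + p.Xd' * y.y₅, p.R * y.y₅ + p.Xd' * y.y₆ + y.y₂ ^ 2;
        p.R * y.y₅ + p.Xq' * y.y₆ + y.y₂ ^ 2, p.R * y.y₆ - p.Xq' * y.y₅] * rot (v 0 - y.y₁))

/-- `𝒢₀(θ₁, θ₂) = (θ₁, θ₂, θ₁², θ₂², θ₁θ₂)`. -/
def G₀ (θ₁ θ₂ : ℝ) : Fin 5 → ℝ := ![θ₁, θ₂, θ₁ ^ 2, θ₂ ^ 2, θ₁ * θ₂]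

/-- Interval excitation: `∫₀^{t_c} ψ ψᵀ > δ I` for some `t_c, δ > 0`. -/
def IntervalExciting (ψ : ℝ → Fin 5 → ℝ) : Prop :=
  ∃ tc δ : ℝ, 0 < tc ∧ 0 < δ ∧
    (Matrix.of (fun i j => ∫ s in (0 : ℝ)..tc, ψ s i * ψ s j)
      - δ • (1 : Matrix (Fin 5) (Fin 5) ℝ)).PosDef

/-- The matrix norm induced by the Euclidean norm. -/
def opNorm (F : Matrix (Fin 5) (Fin 5) ℝ) : ℝ :=
  ‖Matrix.toEuclideanCLM (n := Fin 5) (𝕜 := ℝ) F‖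

/-- Tuning gains. -/
structure Gains where
  γG : ℝ
  γ₁ : ℝ
  γ₂ : ℝ
  f₀ : ℝ
  χ₀ : ℝ
  k : ℝ
  γG_pos : 0 < γG
  γ₁_pos : 0 < γ₁
  γ₂_pos : 0 < γ₂
  f₀_pos : 0 < f₀
  χ₀_pos : 0 < χ₀
  k_ge : 1 / f₀ ≤ k

/-- The internal signals of the LS+DREM estimator. -/
structure Estimator where
  G : ℝ → Fin 5 → ℝ
  F : ℝ → Matrix (Fin 5) (Fin 5) ℝ
  θ₁ : ℝ → ℝ
  θ₂ : ℝ → ℝ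
  z : ℝ → ℝ

namespace Estimator
variable (g : Gains) (e : Estimator)

/-- The forgetting factor `χ = χ₀ (1 - ‖F‖ / k)`. -/
def χ (t : ℝ) : ℝ := g.χ₀ * (1 - opNorm (e.F t) / g.k)

/-- `I - z f₀ F`. -/
def mix (t : ℝ) : Matrix (Fin 5) (Fin 5) ℝ := 1 - (e.z t * g.f₀) • e.F t

/-- `Δ = det (I - z f₀ F)`. -/
def Δ (t : ℝ) : ℝ := (e.mix g t).det

/-- `𝐘 = adj (I - z f₀ F) (Ĝ₀ - z f₀ F Ĝ₀(0))`. -/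
def Y (t : ℝ) : Fin 5 → ℝ :=
  Matrix.mulVec (e.mix g t).adjugate
    (e.G t - (e.z t * g.f₀) • Matrix.mulVec (e.F t) (e.G 0))

/-- `e` is run by the regressor `ψ` and the regressand `𝒴`. -/
structure IsRun (𝒴 : ℝ → ℝ) (ψ : ℝ → Fin 5 → ℝ) : Prop where
  dG : ∀ i, HasRate (fun t => e.G t i) (fun t =>
    g.γG * Matrix.mulVec (e.F t) (ψ t) i * (𝒴 t - ψ t ⬝ᵥ e.G t))
  dF : ∀ i j, HasRate (fun t => e.F t i j) (fun t =>
    (-g.γG • (e.F t * Matrix.vecMulVec (ψ t) (ψ t) * e.F t) + e.χ g t • e.F t) i j)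
  F_init : e.F 0 = (1 / g.f₀) • (1 : Matrix (Fin 5) (Fin 5) ℝ)
  dθ₁ : HasRate e.θ₁ (fun t => g.γ₁ * e.Δ g t * (e.Y g t 0 - e.Δ g t * e.θ₁ t))
  dθ₂ : HasRate e.θ₂ (fun t => g.γ₂ * e.Δ g t * (e.Y g t 1 - e.Δ g t * e.θ₂ t))
  dz : HasRate e.z (fun t => -e.χ g t * e.z t)
  z_init : e.z 0 = 1

/-- The state estimate
`x̂ = (v₁ + arctan (θ̂₁ / θ̂₂), v₂, W(v, y) (θ̂₁, θ̂₂))`. -/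
def xhat (p : Params) (v : ℝ → Fin 2 → ℝ) (y : ℝ → PMU) (t : ℝ) : Fin 4 → ℝ :=
  ![v t 0 + Real.arctan (e.θ₁ t / e.θ₂ t),
    v t 1,
    Matrix.mulVec (W p (v t) (y t)) ![e.θ₁ t, e.θ₂ t] 0,
    Matrix.mulVec (W p (v t) (y t)) ![e.θ₁ t, e.θ₂ t] 1]

end Estimator

end SGObserver

end

/-! The product `S = z f₀ F` is free of the forgetting factor: the terms `χ F` and `-χ z` cancel,
leaving `S' = -γ F ψ ψᵀ S` with `S 0 = 1`. The error of `Ĝ₀` solves the same linear equation, so it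
equals `S` times its initial value (`G_sub_eq`), and the adjugate turns this into decoupled scalar
regressions `Y = Δ G₀` (`Y_eq`).

The inverse of `S` is explicit, `N = 1 + ∫ γ / (f₀ z) ψ ψᵀ` (`S_mul_N`). Hence `S` is symmetric
positive and nonincreasing. This keeps `‖F‖ ≤ k` (`opNorm_F_le`), so `χ ≥ 0` and `z ≤ 1`, and
interval excitation then gives `N ≥ c > 1` from some time on. Thus `Δ = det (1 - S)` stays away from
zero (`exists_le_Δ`), and each `θ̂ᵢ` converges exponentially while remaining a convex combination of
its initial value and its target (`scalar_expToZero`), which preserves the sign bound.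

On the generator side, `x₁ - v₁ + (x₂ - v₂) / a₀` is conserved, and `x₂ - v₂` decays. The stator
equations express `(x₃, x₄)` linearly in the sine and cosine of `x₁ - y₁` (`statorMatrix_mulVec`),
and the arctangent recovers `θ₀` up to a multiple of `π` (`exists_int_angle_branch`). -/

namespace SGObserver

/-! ### Rates -/

lemma HasRate.continuousOn {f g : ℝ → ℝ} (h : HasRate f g) : ContinuousOn f (Ici 0) :=
  fun t ht => (h t ht).continuousWithinAt

lemma HasRate.congr_rate {f g g' : ℝ → ℝ} (h : HasRate f g) (hg : ∀ t, 0 ≤ t → g t = g' t) :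
    HasRate f g' := fun t ht => hg t ht ▸ h t ht

lemma HasRate.sum {ι : Type*} {s : Finset ι} {f g : ι → ℝ → ℝ} (h : ∀ i ∈ s, HasRate (f i) (g i)) :
    HasRate (fun t => ∑ i ∈ s, f i t) (fun t => ∑ i ∈ s, g i t) :=
  fun t ht => HasDerivWithinAt.fun_sum fun i hi => h i hi t ht

lemma HasRate.monotoneOn {f g : ℝ → ℝ} (h : HasRate f g) (hg : ∀ t, 0 ≤ t → 0 ≤ g t) :
    MonotoneOn f (Ici 0) := by
  refine monotoneOn_of_hasDerivWithinAt_nonneg (f' := g) (convex_Ici 0) h.continuousOn ?_ ?_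
  · intro t ht
    exact (h t (interior_subset ht)).mono interior_subset
  · intro t ht
    exact hg t (interior_subset ht)

lemma HasRate.antitoneOn {f g : ℝ → ℝ} (h : HasRate f g) (hg : ∀ t, 0 ≤ t → g t ≤ 0) :
    AntitoneOn f (Ici 0) := by
  refine antitoneOn_of_hasDerivWithinAt_nonpos (f' := g) (convex_Ici 0) h.continuousOn ?_ ?_
  · intro t ht
    exact (h t (interior_subset ht)).mono interior_subset
  · intro t ht
    exact hg t (interior_subset ht)

lemma HasRate.eq_initial {f g : ℝ → ℝ} (h : HasRate f g) (hg : ∀ t, 0 ≤ t → g t = 0)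
    {t : ℝ} (ht : 0 ≤ t) : f t = f 0 :=
  le_antisymm (h.antitoneOn (fun s hs => (hg s hs).le) self_mem_Ici ht ht)
    (h.monotoneOn (fun s hs => (hg s hs).ge) self_mem_Ici ht ht)

lemma hasRate_integral {a : ℝ → ℝ} (ha : ContinuousOn a (Ici 0)) :
    HasRate (fun t => ∫ s in (0 : ℝ)..t, a s) a := by
  -- Extending `a` by its value at `0` makes it continuous on the whole line, so the two-sided
  -- fundamental theorem also covers the endpoint.
  have hc : Continuous fun t : ℝ => a (max t 0) :=
    ha.comp_continuous (continuous_id.max continuous_const) fun t => le_max_right t 0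
  intro t ht
  have h := (hc.integral_hasStrictDerivAt 0 t).hasDerivAt.hasDerivWithinAt (s := Ici 0)
  rw [max_eq_left ht] at h
  have heq : ∀ r ∈ Ici (0 : ℝ), ∫ s in (0 : ℝ)..r, a s = ∫ s in (0 : ℝ)..r, a (max s 0) := by
    intro r hr
    refine intervalIntegral.integral_congr fun s hs => ?_
    rw [uIcc_of_le hr] at hs
    simp only [max_eq_left hs.1]
  exact h.congr heq (heq t ht)

lemma _root_.ContinuousOn.intervalIntegrable_of_Ici {a : ℝ → ℝ} (ha : ContinuousOn a (Ici 0))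
    {s t : ℝ} (hs : 0 ≤ s) (hst : s ≤ t) : IntervalIntegrable a MeasureTheory.volume s t :=
  (ha.mono fun _ hr => hs.trans hr.1).intervalIntegrable_of_Icc hst

/-- The solution of a scalar homogeneous linear equation. -/
lemma HasRate.eq_mul_exp {f a : ℝ → ℝ} (h : HasRate f fun t => -a t * f t)
    (ha : ContinuousOn a (Ici 0)) {t : ℝ} (ht : 0 ≤ t) :
    f t = f 0 * Real.exp (-∫ s in (0 : ℝ)..t, a s) := by
  have hE : HasRate (fun t => f t * Real.exp (∫ s in (0 : ℝ)..t, a s)) fun _ => 0 := by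
    intro s hs
    refine ((h s hs).mul (hasRate_integral ha s hs).exp).congr_deriv ?_
    ring
  have h0 := hE.eq_initial (fun _ _ => rfl) ht
  simp only [intervalIntegral.integral_same, Real.exp_zero, mul_one] at h0
  rw [← h0, mul_assoc, ← Real.exp_add]
  simp

/-- Before `T` the left side is nonpositive; after `T` the contribution of `[0, T]` is dropped. A
rate bounded below only eventually thus costs just a factor `exp (c T)` in the decay estimate. -/
lemma mul_sub_le_integral {a : ℝ → ℝ} (ha : ContinuousOn a (Ici 0)) {c T : ℝ} (hT : 0 ≤ T)
    (hc : 0 ≤ c) (h0 : ∀ t, 0 ≤ t → 0 ≤ a t) (h1 : ∀ t, T ≤ t → c ≤ a t) {t : ℝ} (ht : 0 ≤ t) :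
    c * (t - T) ≤ ∫ s in (0 : ℝ)..t, a s := by
  rcases le_total t T with h | h
  · exact (mul_nonpos_of_nonneg_of_nonpos hc (sub_nonpos.2 h)).trans
      (intervalIntegral.integral_nonneg ht fun s hs => h0 s hs.1)
  · rw [← intervalIntegral.integral_add_adjacent_intervals
      (ha.intervalIntegrable_of_Ici le_rfl hT) (ha.intervalIntegrable_of_Ici hT h)]
    have h2 : ∫ _ in T..t, c ≤ ∫ s in T..t, a s :=
      intervalIntegral.integral_mono_on h intervalIntegrable_const
        (ha.intervalIntegrable_of_Ici hT h) fun s hs => h1 s hs.1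
    have h3 := intervalIntegral.integral_nonneg (μ := MeasureTheory.volume) hT
      fun s hs => h0 s hs.1
    rw [intervalIntegral.integral_const, smul_eq_mul] at h2
    linarith

/-- A homogeneous linear system with continuous coefficients and zero initial value has only the
zero solution. -/
lemma eq_zero_of_hasRate_mulVec {n : Type*} [Fintype n] {A : ℝ → Matrix n n ℝ}
    (hA : ∀ i j, ContinuousOn (fun t => A t i j) (Ici 0)) {X : ℝ → n → ℝ}
    (hX : ∀ i, HasRate (fun t => X t i) fun t => Matrix.mulVec (A t) (X t) i)
    (h0 : X 0 = 0) {t : ℝ} (ht : 0 ≤ t) : X t = 0 := by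
  -- A bound on this sum over `[0, t]` dominates every row sum, so it serves as the Grönwall
  -- constant in the sup norm.
  have hcont : ContinuousOn (fun s => ∑ i, ∑ j, |A s i j|) (Icc 0 t) :=
    continuousOn_finsetSum _ fun i _ => continuousOn_finsetSum _ fun j _ =>
      ((hA i j).mono fun s hs => hs.1).abs
  obtain ⟨K, hK⟩ := isCompact_Icc.exists_bound_of_continuousOn hcont
  have hXd : ∀ s, 0 ≤ s → HasDerivWithinAt X (Matrix.mulVec (A s) (X s)) (Ici 0) s :=
    fun s hs => hasDerivWithinAt_pi.2 fun i => hX i s hs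
  have hK0 : 0 ≤ K := (norm_nonneg _).trans (hK 0 ⟨le_rfl, ht⟩)
  have key := norm_le_gronwallBound_of_norm_deriv_right_le (f := X)
    (f' := fun s => Matrix.mulVec (A s) (X s)) (δ := 0) (K := K) (ε := 0) (a := 0) (b := t)
    (fun s hs => ((hXd s hs.1).continuousWithinAt).mono fun r hr => hr.1)
    (fun s hs => (hXd s hs.1).mono fun r hr => le_trans hs.1 hr)
    (by simp [h0]) ?_ t ⟨ht, le_rfl⟩
  · rw [gronwallBound_ε0_δ0] at key
    exact norm_le_zero_iff.1 key
  · intro s hs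
    rw [add_zero, pi_norm_le_iff_of_nonneg (by positivity)]
    intro i
    have hKs := hK s ⟨hs.1, hs.2.le⟩
    rw [Real.norm_eq_abs] at hKs
    calc ‖Matrix.mulVec (A s) (X s) i‖ ≤ ∑ j, ‖A s i j * X s j‖ := norm_sum_le _ _
      _ ≤ ∑ j, |A s i j| * ‖X s‖ := by
        refine Finset.sum_le_sum fun j _ => ?_
        rw [norm_mul]
        exact mul_le_mul_of_nonneg_left (norm_le_pi_norm _ j) (norm_nonneg _)
      _ = (∑ j, |A s i j|) * ‖X s‖ := by rw [Finset.sum_mul]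
      _ ≤ K * ‖X s‖ := by
        refine mul_le_mul_of_nonneg_right ?_ (norm_nonneg _)
        exact (Finset.single_le_sum (f := fun i => ∑ j, |A s i j|)
          (fun i _ => Finset.sum_nonneg fun j _ => abs_nonneg _) (Finset.mem_univ i)).trans
          ((le_abs_self _).trans hKs)

/-! ### Bounded and exponentially decaying signals -/

lemma BddSignal.of_le {f g : ℝ → ℝ} (hg : BddSignal g) (h : ∀ t, 0 ≤ t → |f t| ≤ |g t|) :
    BddSignal f :=
  let ⟨C, hC⟩ := hg
  ⟨C, fun t ht => (h t ht).trans (hC t ht)⟩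

lemma BddSignal.congr {f g : ℝ → ℝ} (hg : BddSignal g) (h : ∀ t, 0 ≤ t → f t = g t) :
    BddSignal f := hg.of_le fun t ht => by rw [h t ht]

lemma bddSignal_const (c : ℝ) : BddSignal fun _ => c := ⟨|c|, fun _ _ => le_rfl⟩

lemma BddSignal.add {f g : ℝ → ℝ} (hf : BddSignal f) (hg : BddSignal g) :
    BddSignal fun t => f t + g t :=
  let ⟨A, hA⟩ := hf
  let ⟨B, hB⟩ := hg
  ⟨A + B, fun t ht => (abs_add_le _ _).trans (add_le_add (hA t ht) (hB t ht))⟩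

lemma BddSignal.neg {f : ℝ → ℝ} (hf : BddSignal f) : BddSignal fun t => -f t :=
  hf.of_le fun t _ => (abs_neg (f t)).le

lemma BddSignal.sub {f g : ℝ → ℝ} (hf : BddSignal f) (hg : BddSignal g) :
    BddSignal fun t => f t - g t := (hf.add hg.neg).congr fun _ _ => sub_eq_add_neg _ _

lemma BddSignal.mul {f g : ℝ → ℝ} (hf : BddSignal f) (hg : BddSignal g) :
    BddSignal fun t => f t * g t := by
  obtain ⟨A, hA⟩ := hf
  obtain ⟨B, hB⟩ := hg
  refine ⟨A * B, fun t ht => ?_⟩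
  rw [abs_mul]
  exact mul_le_mul (hA t ht) (hB t ht) (abs_nonneg _) ((abs_nonneg _).trans (hA t ht))

lemma BddSignal.sum {ι : Type*} {s : Finset ι} {f : ι → ℝ → ℝ} (h : ∀ i ∈ s, BddSignal (f i)) :
    BddSignal fun t => ∑ i ∈ s, f i t := by
  choose! C hC using h
  exact ⟨∑ i ∈ s, C i, fun t ht => (Finset.abs_sum_le_sum_abs _ _).trans
    (Finset.sum_le_sum fun i hi => hC i hi t ht)⟩

lemma bddSignal_sin (f : ℝ → ℝ) : BddSignal fun t => Real.sin (f t) :=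
  ⟨1, fun _ _ => Real.abs_sin_le_one _⟩

lemma bddSignal_cos (f : ℝ → ℝ) : BddSignal fun t => Real.cos (f t) :=
  ⟨1, fun _ _ => Real.abs_cos_le_one _⟩

lemma ExpToZero.of_le {f g : ℝ → ℝ} (hg : ExpToZero g) (h : ∀ t, 0 ≤ t → |f t| ≤ |g t|) :
    ExpToZero f :=
  let ⟨C, α, hC, hα, H⟩ := hg
  ⟨C, α, hC, hα, fun t ht => (h t ht).trans (H t ht)⟩

lemma ExpToZero.congr {f g : ℝ → ℝ} (hg : ExpToZero g) (h : ∀ t, 0 ≤ t → f t = g t) :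
    ExpToZero f := hg.of_le fun t ht => by rw [h t ht]

lemma ExpToZero.bddSignal {f : ℝ → ℝ} (hf : ExpToZero f) : BddSignal f := by
  obtain ⟨C, α, hC, hα, H⟩ := hf
  refine ⟨C, fun t ht => (H t ht).trans (mul_le_of_le_one_right hC.le ?_)⟩
  rw [Real.exp_le_one_iff, neg_mul, neg_nonpos]
  positivity

lemma ExpToZero.add {f g : ℝ → ℝ} (hf : ExpToZero f) (hg : ExpToZero g) :
    ExpToZero fun t => f t + g t := by
  obtain ⟨A, α, hA, hα, H⟩ := hf
  obtain ⟨B, β, hB, hβ, K⟩ := hg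
  refine ⟨A + B, min α β, by positivity, lt_min hα hβ, fun t ht => ?_⟩
  rw [add_mul]
  refine (abs_add_le _ _).trans (add_le_add ((H t ht).trans ?_) ((K t ht).trans ?_))
  · gcongr
    exact min_le_left α β
  · gcongr
    exact min_le_right α β

lemma ExpToZero.neg {f : ℝ → ℝ} (hf : ExpToZero f) : ExpToZero fun t => -f t :=
  hf.of_le fun t _ => (abs_neg (f t)).le

lemma ExpToZero.mul_bdd {f g : ℝ → ℝ} (hf : ExpToZero f) (hg : BddSignal g) :
    ExpToZero fun t => f t * g t := by
  obtain ⟨A, α, hA, hα, H⟩ := hf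
  obtain ⟨B, K⟩ := hg
  have hB : 0 ≤ B := (abs_nonneg _).trans (K 0 le_rfl)
  refine ⟨A * (B + 1), α, by positivity, hα, fun t ht => ?_⟩
  rw [abs_mul, mul_right_comm]
  exact mul_le_mul (H t ht) ((K t ht).trans (by linarith)) (abs_nonneg _) (by positivity)

lemma ExpToZero.const_mul {f : ℝ → ℝ} (c : ℝ) (hf : ExpToZero f) : ExpToZero fun t => c * f t :=
  (hf.mul_bdd (bddSignal_const c)).congr fun _ _ => mul_comm _ _

lemma expToZero_exp {α : ℝ} (hα : 0 < α) : ExpToZero fun t => Real.exp (-α * t) :=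
  ⟨1, α, one_pos, hα, fun t _ => by rw [abs_of_pos (Real.exp_pos _), one_mul]⟩

/-- A scalar equation whose decay rate is eventually bounded below. -/
lemma HasRate.expToZero {f a : ℝ → ℝ} (h : HasRate f fun t => -a t * f t)
    (ha : ContinuousOn a (Ici 0)) {c T : ℝ} (hT : 0 ≤ T)
    (hc : 0 < c) (h0 : ∀ t, 0 ≤ t → 0 ≤ a t) (h1 : ∀ t, T ≤ t → c ≤ a t) : ExpToZero f := by
  refine ((expToZero_exp hc).const_mul (f 0 * Real.exp (c * T))).of_le fun t ht => ?_
  rw [h.eq_mul_exp ha ht, mul_assoc, abs_mul, abs_mul, ← Real.exp_add, Real.abs_exp, Real.abs_exp]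
  refine mul_le_mul_of_nonneg_left (Real.exp_le_exp.2 ?_) (abs_nonneg _)
  have := mul_sub_le_integral ha hT hc.le h0 h1 ht
  linarith

open Matrix

/-! ### Quadratic forms -/

section QuadraticForms

variable {n : Type*} [Fintype n]

lemma _root_.Matrix.dotProduct_mulVec_comm_of_isSymm {A : Matrix n n ℝ} (hA : A.IsSymm)
    (x y : n → ℝ) : x ⬝ᵥ A *ᵥ y = y ⬝ᵥ A *ᵥ x := by
  rw [dotProduct_mulVec, ← mulVec_transpose, hA.eq, dotProduct_comm]

/-- Cauchy–Schwarz for a semidefinite form: the form at `x + r • y` is a nonnegative quadratic in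
`r`, so its discriminant is nonpositive. -/
lemma _root_.Matrix.sq_dotProduct_mulVec_le {A : Matrix n n ℝ} (hA : A.IsSymm)
    (h0 : ∀ w, 0 ≤ w ⬝ᵥ A *ᵥ w) (x y : n → ℝ) :
    (x ⬝ᵥ A *ᵥ y) ^ 2 ≤ (x ⬝ᵥ A *ᵥ x) * (y ⬝ᵥ A *ᵥ y) := by
  have h := discrim_le_zero (a := y ⬝ᵥ A *ᵥ y) (b := 2 * (x ⬝ᵥ A *ᵥ y)) (c := x ⬝ᵥ A *ᵥ x)
    fun r => by
      have := h0 (x + r • y)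
      simp only [mulVec_add, mulVec_smul, dotProduct_add, add_dotProduct, smul_dotProduct,
        dotProduct_smul, smul_eq_mul, dotProduct_mulVec_comm_of_isSymm hA y x] at this
      linarith
  rw [discrim] at h
  linarith

lemma sq_dotProduct_le (x y : n → ℝ) : (x ⬝ᵥ y) ^ 2 ≤ (x ⬝ᵥ x) * (y ⬝ᵥ y) := by
  simpa only [dotProduct, ← sq] using Finset.sum_mul_sq_le_sq_mul_sq Finset.univ x y

lemma dotProduct_self_nonneg_real (x : n → ℝ) : 0 ≤ x ⬝ᵥ x :=
  Finset.sum_nonneg fun i _ => mul_self_nonneg (x i)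

/-- Lower bound for the determinant of a symmetric matrix with large quadratic form. -/
lemma _root_.Matrix.pow_card_le_det [DecidableEq n] {A : Matrix n n ℝ} (hA : A.IsSymm) {η : ℝ}
    (hη : 0 ≤ η) (h : ∀ w, η * (w ⬝ᵥ w) ≤ w ⬝ᵥ A *ᵥ w) : η ^ Fintype.card n ≤ A.det := by
  have hH : A.IsHermitian := by
    rw [IsHermitian, conjTranspose_eq_transpose_of_trivial, hA.eq]
  -- Each eigenvalue is the quadratic form at a unit eigenvector, hence at least `η`.
  rw [hH.det_eq_prod_eigenvalues, ← Finset.card_univ, ← Finset.prod_const]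
  refine Finset.prod_le_prod (fun _ _ => hη) fun i _ => ?_
  have h1 := h (hH.eigenvectorBasis i)
  have h2 : ⇑(hH.eigenvectorBasis i) ⬝ᵥ ⇑(hH.eigenvectorBasis i) = 1 := by
    have := EuclideanSpace.inner_eq_star_dotProduct (hH.eigenvectorBasis i) (hH.eigenvectorBasis i)
    rw [star_trivial, real_inner_self_eq_norm_sq, hH.eigenvectorBasis.orthonormal.1 i] at this
    linarith
  rw [hH.mulVec_eigenvectorBasis, dotProduct_smul, h2, smul_eq_mul, mul_one, mul_one] at h1
  exact h1

end QuadraticForms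

lemma norm_sq_toLp (w : Fin 5 → ℝ) : ‖WithLp.toLp 2 w‖ ^ 2 = w ⬝ᵥ w := by
  rw [EuclideanSpace.real_norm_sq_eq]
  simp [dotProduct, sq]

lemma opNorm_nonneg (A : Matrix (Fin 5) (Fin 5) ℝ) : 0 ≤ opNorm A := norm_nonneg _

lemma opNorm_smul (c : ℝ) (A : Matrix (Fin 5) (Fin 5) ℝ) : opNorm (c • A) = |c| * opNorm A := by
  rw [opNorm, opNorm, map_smul, norm_smul, Real.norm_eq_abs]

lemma continuous_opNorm : Continuous opNorm :=
  (LinearMap.continuous_of_finiteDimensional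
    ((toEuclideanCLM (n := Fin 5) (𝕜 := ℝ)).toAlgEquiv.toLinearMap)).norm

lemma dotProduct_mulVec_le_opNorm (A : Matrix (Fin 5) (Fin 5) ℝ) (w : Fin 5 → ℝ) :
    w ⬝ᵥ A *ᵥ w ≤ opNorm A * (w ⬝ᵥ w) := by
  have h := inner_toEuclideanCLM A (WithLp.toLp 2 w) (WithLp.toLp 2 w)
  calc w ⬝ᵥ A *ᵥ w = _ := h.symm
    _ ≤ ‖WithLp.toLp 2 w‖ * ‖toEuclideanCLM (𝕜 := ℝ) A (WithLp.toLp 2 w)‖ := real_inner_le_norm _ _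
    _ ≤ ‖WithLp.toLp 2 w‖ * (opNorm A * ‖WithLp.toLp 2 w‖) :=
      mul_le_mul_of_nonneg_left (ContinuousLinearMap.le_opNorm _ _) (norm_nonneg _)
    _ = opNorm A * (w ⬝ᵥ w) := by rw [← norm_sq_toLp]; ring

/-- Cauchy–Schwarz for the form of `A` at `A w` and `w` gives `|A w|⁴ ≤ c² |A w|² |w|²`; divide by
`|A w|²`. -/
lemma opNorm_le_of_dotProduct_mulVec_le {A : Matrix (Fin 5) (Fin 5) ℝ} (hA : A.IsSymm)
    (h0 : ∀ w, 0 ≤ w ⬝ᵥ A *ᵥ w) {c : ℝ} (hc : 0 ≤ c) (h : ∀ w, w ⬝ᵥ A *ᵥ w ≤ c * (w ⬝ᵥ w)) :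
    opNorm A ≤ c := by
  refine ContinuousLinearMap.opNorm_le_bound _ hc fun x => ?_
  set w := WithLp.ofLp x
  have hx : x = WithLp.toLp 2 w := rfl
  rw [hx, toEuclideanCLM_toLp]
  refine abs_le_of_sq_le_sq' ?_ (by positivity) |>.2
  rw [mul_pow, norm_sq_toLp, norm_sq_toLp]
  have h1 := sq_dotProduct_mulVec_le hA h0 (A *ᵥ w) w
  have h2 := mul_le_mul (h (A *ᵥ w)) (h w) (h0 w)
    (mul_nonneg hc (dotProduct_self_nonneg_real (A *ᵥ w)))
  rcases (dotProduct_self_nonneg_real (A *ᵥ w)).eq_or_lt with h3 | h3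
  · rw [← h3]
    exact mul_nonneg (sq_nonneg c) (dotProduct_self_nonneg_real w)
  · refine le_of_mul_le_mul_left ?_ h3
    calc _ = ((A *ᵥ w) ⬝ᵥ A *ᵥ w) ^ 2 := (sq _).symm
      _ ≤ _ := h1.trans h2
      _ = _ := by ring

lemma abs_apply_le_opNorm (A : Matrix (Fin 5) (Fin 5) ℝ) (i j : Fin 5) : |A i j| ≤ opNorm A := by
  have h := ContinuousLinearMap.le_opNorm (toEuclideanCLM (n := Fin 5) (𝕜 := ℝ) A)
    (EuclideanSpace.single j 1)
  rw [PiLp.norm_single, norm_one, mul_one] at h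
  refine le_trans (le_of_eq ?_) ((PiLp.norm_apply_le _ i).trans h)
  rw [Real.norm_eq_abs, EuclideanSpace.single, ofLp_toEuclideanCLM]
  simp

/-! ### The least-squares estimator -/

namespace Estimator

variable {g : Gains} {e : Estimator} {𝒴 : ℝ → ℝ} {ψ : ℝ → Fin 5 → ℝ}

/-- The matrix `S = z f₀ F`, the transition matrix of the estimation error of `Ĝ₀`. -/
noncomputable def S (g : Gains) (e : Estimator) (t : ℝ) : Matrix (Fin 5) (Fin 5) ℝ := (e.z t * g.f₀) • e.F t

lemma mix_eq (t : ℝ) : e.mix g t = 1 - e.S g t := rfl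

/-- The factors `F ψ` and `ψᵀ F` are kept apart because symmetry of `F` is not yet available. -/
lemma IsRun.F_rate (he : e.IsRun g 𝒴 ψ) (i j : Fin 5) : HasRate (fun t => e.F t i j) fun t =>
    -g.γG * ((e.F t *ᵥ ψ t) i * (ψ t ᵥ* e.F t) j) + e.χ g t * e.F t i j := by
  refine (he.dF i j).congr_rate fun t _ => ?_
  simp [mul_vecMulVec, vecMulVec_mul, vecMulVec_apply]

lemma IsRun.continuousOn_F (he : e.IsRun g 𝒴 ψ) (i j : Fin 5) :
    ContinuousOn (fun t => e.F t i j) (Ici 0) := (he.dF i j).continuousOn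

lemma IsRun.continuousOn_χ (he : e.IsRun g 𝒴 ψ) : ContinuousOn (e.χ g) (Ici 0) := by
  have hF : ContinuousOn e.F (Ici 0) :=
    continuousOn_pi.2 fun i => continuousOn_pi.2 fun j => he.continuousOn_F i j
  exact continuousOn_const.mul (continuousOn_const.sub
    ((continuous_opNorm.comp_continuousOn hF).div_const _))

lemma IsRun.z_eq (he : e.IsRun g 𝒴 ψ) {t : ℝ} (ht : 0 ≤ t) :
    e.z t = Real.exp (-∫ s in (0 : ℝ)..t, e.χ g s) := by
  rw [he.dz.eq_mul_exp he.continuousOn_χ ht, he.z_init, one_mul]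

lemma IsRun.z_pos (he : e.IsRun g 𝒴 ψ) {t : ℝ} (ht : 0 ≤ t) : 0 < e.z t :=
  he.z_eq ht ▸ Real.exp_pos _

lemma IsRun.S_init (he : e.IsRun g 𝒴 ψ) : e.S g 0 = 1 := by
  rw [S, he.z_init, he.F_init, smul_smul, one_mul, mul_one_div_cancel g.f₀_pos.ne', one_smul]

/-- The forgetting terms of `z` and `F` cancel in the product. -/
lemma IsRun.S_rate (he : e.IsRun g 𝒴 ψ) (i j : Fin 5) : HasRate (fun t => e.S g t i j) fun t =>
    -g.γG * (e.F t *ᵥ ψ t) i * (ψ t ᵥ* e.S g t) j := by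
  intro t ht
  refine (((he.dz t ht).mul_const g.f₀).mul (he.F_rate i j t ht)).congr_deriv ?_
  simp only [S, vecMul_smul, Pi.smul_apply, smul_eq_mul]
  ring

lemma IsRun.S_mulVec_rate (he : e.IsRun g 𝒴 ψ) (w : Fin 5 → ℝ) (i : Fin 5) :
    HasRate (fun t => (e.S g t *ᵥ w) i) fun t =>
      -g.γG * (e.F t *ᵥ ψ t) i * (ψ t ⬝ᵥ e.S g t *ᵥ w) := by
  refine (HasRate.sum (s := Finset.univ) fun j _ => fun t ht =>
    (he.S_rate i j t ht).mul_const (w j)).congr_rate fun t _ => ?_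
  rw [dotProduct_mulVec, dotProduct, Finset.mul_sum]
  exact Finset.sum_congr rfl fun j _ => by ring

/-- Uniqueness for the error equation `Ẋ = -γ F ψ ψᵀ X`. -/
lemma IsRun.eq_zero_of_hasRate (he : e.IsRun g 𝒴 ψ) (hψ : ContinuousOn ψ (Ici 0))
    {X : ℝ → Fin 5 → ℝ} (h0 : X 0 = 0)
    (hX : ∀ i, HasRate (fun t => X t i) fun t => -g.γG * (e.F t *ᵥ ψ t) i * (ψ t ⬝ᵥ X t))
    {t : ℝ} (ht : 0 ≤ t) : X t = 0 := by
  have hψi := continuousOn_pi.1 hψ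
  refine eq_zero_of_hasRate_mulVec (A := fun t => vecMulVec (-g.γG • e.F t *ᵥ ψ t) (ψ t))
    (fun i j => ?_) (fun i => (hX i).congr_rate fun s _ => ?_) h0 ht
  · have : ContinuousOn (fun t => (e.F t *ᵥ ψ t) i) (Ici 0) :=
      continuousOn_finsetSum Finset.univ fun k _ => (he.continuousOn_F i k).mul (hψi k)
    exact (continuousOn_const.mul this).mul (hψi j)
  · rw [vecMulVec_mulVec]
    simp [mul_comm, mul_left_comm]

/-- The estimation error of `Ĝ₀` is transported by `S`. -/
lemma IsRun.G_sub_eq (he : e.IsRun g 𝒴 ψ) (hψ : ContinuousOn ψ (Ici 0)) {G : Fin 5 → ℝ}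
    (hreg : ∀ t, 0 ≤ t → 𝒴 t = ψ t ⬝ᵥ G) {t : ℝ} (ht : 0 ≤ t) :
    e.G t - G = e.S g t *ᵥ (e.G 0 - G) := by
  -- Both sides solve the same linear equation and agree at `0`, where `S` is the identity.
  refine sub_eq_zero.1 (he.eq_zero_of_hasRate hψ
    (X := fun t => e.G t - G - e.S g t *ᵥ (e.G 0 - G)) ?_ (fun i s hs => ?_) ht)
  · simp [he.S_init]
  · refine (((he.dG i s hs).sub_const (G i)).sub
      (he.S_mulVec_rate (e.G 0 - G) i s hs)).congr_deriv ?_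
    beta_reduce
    rw [hreg s hs, dotProduct_sub, dotProduct_sub]
    ring

/-- Rearranging the error formula gives `Ĝ₀ - S Ĝ₀(0) = (1 - S) G`; the adjugate replaces `1 - S` by
its determinant. -/
lemma IsRun.Y_eq (he : e.IsRun g 𝒴 ψ) (hψ : ContinuousOn ψ (Ici 0)) {G : Fin 5 → ℝ}
    (hreg : ∀ t, 0 ≤ t → 𝒴 t = ψ t ⬝ᵥ G) {t : ℝ} (ht : 0 ≤ t) :
    e.Y g t = e.Δ g t • G := by
  have h : e.G t - (e.z t * g.f₀) • e.F t *ᵥ e.G 0 = e.mix g t *ᵥ G := by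
    have h1 := he.G_sub_eq hψ hreg ht
    rw [mulVec_sub, sub_eq_iff_eq_add] at h1
    rw [mix_eq, sub_mulVec, one_mulVec, ← smul_mulVec, h1]
    change e.S g t *ᵥ e.G 0 - _ + _ - e.S g t *ᵥ e.G 0 = _
    abel
  rw [Y, h, mulVec_mulVec, adjugate_mul, smul_mulVec, one_mulVec, Δ]

/-- The inverse of `S`. -/
noncomputable def N (g : Gains) (e : Estimator) (ψ : ℝ → Fin 5 → ℝ) (t : ℝ) : Matrix (Fin 5) (Fin 5) ℝ :=
  -- Formally `(S⁻¹)' = -S⁻¹ S' S⁻¹ = γ S⁻¹ F ψ ψᵀ`, and `S⁻¹ F = 1 / (z f₀)`.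
  1 + of fun i j => ∫ s in (0 : ℝ)..t, g.γG / g.f₀ / e.z s * (ψ s i * ψ s j)

lemma N_init : N g e ψ 0 = 1 := by
  ext i j
  simp [N]

lemma N_isSymm (t : ℝ) : (N g e ψ t).IsSymm := by
  ext i j
  simp only [N, transpose_apply, Matrix.add_apply, of_apply, mul_comm (ψ _ i), one_apply,
    eq_comm (a := i)]

lemma IsRun.N_rate (he : e.IsRun g 𝒴 ψ) (hψ : ContinuousOn ψ (Ici 0)) (i j : Fin 5) :
    HasRate (fun t => N g e ψ t i j) fun t => g.γG / g.f₀ / e.z t * (ψ t i * ψ t j) := by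
  have hψi := continuousOn_pi.1 hψ
  intro t ht
  exact (hasRate_integral ((continuousOn_const.div he.dz.continuousOn
    fun s hs => (he.z_pos hs).ne').mul ((hψi i).mul (hψi j))) t ht).const_add _

/-- Since `S N' = γ F ψ ψᵀ`, every column of `S N - 1` solves the error equation with zero initial
value. Invertibility of `F` is not presupposed. -/
lemma IsRun.S_mul_N (he : e.IsRun g 𝒴 ψ) (hψ : ContinuousOn ψ (Ici 0)) {t : ℝ} (ht : 0 ≤ t) :
    e.S g t * N g e ψ t = 1 := by
  ext i j
  refine sub_eq_zero.1 (congrFun (he.eq_zero_of_hasRate hψ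
    (X := fun t i => (e.S g t * N g e ψ t) i j - (1 : Matrix (Fin 5) (Fin 5) ℝ) i j)
    ?_ (fun i s hs => ?_) ht) i)
  · ext i
    simp [he.S_init, N_init]
  · refine (HasDerivWithinAt.sub_const ((1 : Matrix (Fin 5) (Fin 5) ℝ) i j)
      (HasDerivWithinAt.fun_sum (u := Finset.univ) fun k _ =>
        (he.S_rate i k s hs).mul (he.N_rate hψ k j s hs))).congr_deriv ?_
    have hz := (he.z_pos hs).ne'
    have hf := g.f₀_pos.ne'
    have h1 : ψ s ⬝ᵥ (fun i => (e.S g s * N g e ψ s) i j - (1 : Matrix (Fin 5) (Fin 5) ℝ) i j)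
        = ∑ k, (ψ s ᵥ* e.S g s) k * N g e ψ s k j - ψ s j := by
      change ψ s ⬝ᵥ ((e.S g s * N g e ψ s).col j - (1 : Matrix (Fin 5) (Fin 5) ℝ).col j) = _
      rw [dotProduct_sub]
      change (ψ s ᵥ* (e.S g s * N g e ψ s)) j - (ψ s ᵥ* 1) j = _
      rw [vecMul_one, ← vecMul_vecMul]
      rfl
    have h2 : ∑ k, e.S g s i k * (g.γG / g.f₀ / e.z s * (ψ s k * ψ s j))
        = g.γG * (e.F s *ᵥ ψ s) i * ψ s j := by
      simp only [S, Matrix.smul_apply, smul_eq_mul, mulVec, dotProduct, Finset.mul_sum, Finset.sum_mul]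
      refine Finset.sum_congr rfl fun k _ => ?_
      field_simp
    beta_reduce
    rw [Finset.sum_add_distrib, h1, h2, mul_sub, Finset.mul_sum]
    simp only [mul_assoc]
    ring

/-- The inverse of the symmetric `N` is symmetric; no uniqueness argument for the nonlinear equation
of `F` is needed. -/
lemma IsRun.S_isSymm (he : e.IsRun g 𝒴 ψ) (hψ : ContinuousOn ψ (Ici 0)) {t : ℝ} (ht : 0 ≤ t) :
    (e.S g t).IsSymm := by
  have h1 := he.S_mul_N hψ ht
  have h2 := congrArg transpose h1
  rw [transpose_mul, (N_isSymm t).eq, transpose_one] at h2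
  have h3 : e.S g t * N g e ψ t * (e.S g t)ᵀ = e.S g t := by rw [mul_assoc, h2, mul_one]
  rw [h1, one_mul] at h3
  exact h3

lemma IsRun.N_quadratic_rate (he : e.IsRun g 𝒴 ψ) (hψ : ContinuousOn ψ (Ici 0))
    (w : Fin 5 → ℝ) : HasRate (fun t => w ⬝ᵥ N g e ψ t *ᵥ w) fun t =>
      g.γG / g.f₀ / e.z t * (w ⬝ᵥ ψ t) ^ 2 := by
  refine (HasRate.sum (s := Finset.univ) fun i _ => fun t ht =>
    (HasDerivWithinAt.fun_sum (u := Finset.univ) fun j _ =>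
      (he.N_rate hψ i j t ht).mul_const (w j)).const_mul (w i)).congr_rate fun t _ => ?_
  simp only [dotProduct, sq, Finset.mul_sum, Finset.sum_mul]
  rw [Finset.sum_comm]
  exact Finset.sum_congr rfl fun i _ => Finset.sum_congr rfl fun j _ => by ring

/-- By symmetry and `F ψ = S ψ / (z f₀)` the rate is minus a square with positive weight, so the
form of `S` is nonincreasing. -/
lemma IsRun.S_quadratic_rate (he : e.IsRun g 𝒴 ψ) (hψ : ContinuousOn ψ (Ici 0))
    (w : Fin 5 → ℝ) : HasRate (fun t => w ⬝ᵥ e.S g t *ᵥ w) fun t =>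
      -(g.γG / g.f₀ / e.z t * (w ⬝ᵥ e.S g t *ᵥ ψ t) ^ 2) := by
  intro t ht
  refine (HasDerivWithinAt.fun_sum (u := Finset.univ) fun i _ =>
    (he.S_mulVec_rate w i t ht).const_mul (w i)).congr_deriv ?_
  have hz := (he.z_pos ht).ne'
  have hf := g.f₀_pos.ne'
  have h1 : w ⬝ᵥ e.S g t *ᵥ ψ t = e.z t * g.f₀ * (w ⬝ᵥ e.F t *ᵥ ψ t) := by
    rw [S, smul_mulVec, dotProduct_smul, smul_eq_mul]
  calc _ = -g.γG * (w ⬝ᵥ e.F t *ᵥ ψ t) * (ψ t ⬝ᵥ e.S g t *ᵥ w) := by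
        rw [dotProduct, Finset.mul_sum, Finset.sum_mul]
        exact Finset.sum_congr rfl fun i _ => by ring
    _ = _ := by
        beta_reduce
        rw [dotProduct_mulVec_comm_of_isSymm (he.S_isSymm hψ ht) (ψ t) w, h1, neg_mul, neg_mul]
        congr 1
        field_simp

lemma IsRun.dotProduct_le_N (he : e.IsRun g 𝒴 ψ) (hψ : ContinuousOn ψ (Ici 0))
    (w : Fin 5 → ℝ) {t : ℝ} (ht : 0 ≤ t) : w ⬝ᵥ w ≤ w ⬝ᵥ N g e ψ t *ᵥ w := by
  have := (he.N_quadratic_rate hψ w).monotoneOn (fun s hs => by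
    have := g.γG_pos; have := g.f₀_pos; have := he.z_pos hs; positivity) self_mem_Ici ht ht
  simpa [N_init] using this

/-- The quadratic form of `S` in terms of that of its inverse. -/
lemma IsRun.S_quadratic_eq (he : e.IsRun g 𝒴 ψ) (hψ : ContinuousOn ψ (Ici 0))
    (w : Fin 5 → ℝ) {t : ℝ} (ht : 0 ≤ t) :
    w ⬝ᵥ e.S g t *ᵥ w = (e.S g t *ᵥ w) ⬝ᵥ N g e ψ t *ᵥ (e.S g t *ᵥ w) := by
  rw [mulVec_mulVec, mul_eq_one_comm.1 (he.S_mul_N hψ ht), one_mulVec, dotProduct_comm]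

lemma IsRun.S_quadratic_nonneg (he : e.IsRun g 𝒴 ψ) (hψ : ContinuousOn ψ (Ici 0))
    (w : Fin 5 → ℝ) {t : ℝ} (ht : 0 ≤ t) : 0 ≤ w ⬝ᵥ e.S g t *ᵥ w := by
  rw [he.S_quadratic_eq hψ w ht]
  exact (dotProduct_self_nonneg_real _).trans (he.dotProduct_le_N hψ _ ht)

/-- With `q = wᵀ S w`, the bound on `N` at `S w` reads `c |S w|² ≤ q`, and `q² ≤ |w|² |S w|²`; hence
`c q² ≤ |w|² q`. -/
lemma IsRun.S_quadratic_le (he : e.IsRun g 𝒴 ψ) (hψ : ContinuousOn ψ (Ici 0)) {t : ℝ}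
    (ht : 0 ≤ t) {c : ℝ} (hc : 0 < c) (hN : ∀ w, c * (w ⬝ᵥ w) ≤ w ⬝ᵥ N g e ψ t *ᵥ w)
    (w : Fin 5 → ℝ) : w ⬝ᵥ e.S g t *ᵥ w ≤ 1 / c * (w ⬝ᵥ w) := by
  have h1 := hN (e.S g t *ᵥ w)
  rw [← he.S_quadratic_eq hψ w ht] at h1
  have h2 := sq_dotProduct_le w (e.S g t *ᵥ w)
  have h0 := he.S_quadratic_nonneg hψ w ht
  set q := w ⬝ᵥ e.S g t *ᵥ w
  have hw := dotProduct_self_nonneg_real w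
  rcases h0.eq_or_lt with h | h
  · rw [← h]
    positivity
  · rw [one_div, ← div_eq_inv_mul, le_div_iff₀ hc]
    refine le_of_mul_le_mul_left ?_ h
    calc q * (q * c) = c * q ^ 2 := by ring
      _ ≤ c * ((w ⬝ᵥ w) * ((e.S g t *ᵥ w) ⬝ᵥ (e.S g t *ᵥ w))) := by gcongr
      _ = (w ⬝ᵥ w) * (c * ((e.S g t *ᵥ w) ⬝ᵥ (e.S g t *ᵥ w))) := by ring
      _ ≤ (w ⬝ᵥ w) * q := by gcongr
      _ = q * (w ⬝ᵥ w) := by ring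

lemma IsRun.opNorm_S_antitone (he : e.IsRun g 𝒴 ψ) (hψ : ContinuousOn ψ (Ici 0)) {s t : ℝ}
    (hs : 0 ≤ s) (hst : s ≤ t) : opNorm (e.S g t) ≤ opNorm (e.S g s) := by
  have ht := hs.trans hst
  refine opNorm_le_of_dotProduct_mulVec_le (he.S_isSymm hψ ht)
    (fun w => he.S_quadratic_nonneg hψ w ht) (opNorm_nonneg _) fun w => ?_
  refine le_trans ?_ (dotProduct_mulVec_le_opNorm (e.S g s) w)
  exact (he.S_quadratic_rate hψ w).antitoneOn (fun r hr => neg_nonpos.2 (by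
    have := g.γG_pos; have := g.f₀_pos; have := he.z_pos hr; positivity)) hs ht hst

/-! ### Covariance bound and sign of the forgetting factor. -/

lemma _root_.SGObserver.Gains.k_pos (g : Gains) : 0 < g.k :=
  (one_div_pos.2 g.f₀_pos).trans_le g.k_ge

lemma IsRun.continuousOn_opNorm_F (he : e.IsRun g 𝒴 ψ) :
    ContinuousOn (fun t => opNorm (e.F t)) (Ici 0) :=
  continuous_opNorm.comp_continuousOn
    (continuousOn_pi.2 fun i => continuousOn_pi.2 fun j => he.continuousOn_F i j)

lemma opNorm_one_le : opNorm 1 ≤ 1 := by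
  refine opNorm_le_of_dotProduct_mulVec_le isSymm_one ?_ zero_le_one ?_ <;> intro w
  · simpa using dotProduct_self_nonneg_real w
  · simp

/-- The covariance matrix stays in the ball of radius `k`. -/
lemma IsRun.opNorm_F_le (he : e.IsRun g 𝒴 ψ) (hψ : ContinuousOn ψ (Ici 0)) {t : ℝ}
    (ht : 0 ≤ t) : opNorm (e.F t) ≤ g.k := by
  by_contra! hk
  have h0 : opNorm (e.F 0) ≤ g.k := by
    rw [he.F_init, opNorm_smul, abs_of_pos (one_div_pos.2 g.f₀_pos)]
    exact (mul_le_of_le_one_right (one_div_pos.2 g.f₀_pos).le opNorm_one_le).trans g.k_ge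
  have hc : ContinuousOn (fun t => opNorm (e.F t)) (Icc 0 t) :=
    he.continuousOn_opNorm_F.mono fun s hs => hs.1
  have hcl : IsClosed (Icc 0 t ∩ (fun t => opNorm (e.F t)) ⁻¹' Iic g.k) :=
    hc.preimage_isClosed_of_isClosed isClosed_Icc isClosed_Iic
  -- Let `s` be the last time before `t` with norm at most `k`. After `s` the factor `χ` is
  -- negative, so `z` does not decrease, while `‖S‖ = z f₀ ‖F‖` does not increase. Hence `‖F t‖ ≤ ‖F
  -- s‖ ≤ k`, a contradiction obtained without differentiating the norm.
  obtain ⟨s, ⟨hs, hsk⟩, hmax⟩ := (isCompact_Icc.of_isClosed_subset hcl inter_subset_left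
    ).exists_isGreatest ⟨0, ⟨le_rfl, ht⟩, h0⟩
  have hgt : ∀ r, s < r → r ≤ t → g.k < opNorm (e.F r) := fun r hr hrt => by
    by_contra! hle
    exact absurd (hmax ⟨⟨hs.1.trans hr.le, hrt⟩, hle⟩) (not_le.2 hr)
  have hz : e.z s ≤ e.z t := by
    rw [he.z_eq hs.1, he.z_eq ht, Real.exp_le_exp, neg_le_neg_iff,
      ← intervalIntegral.integral_add_adjacent_intervals
        (he.continuousOn_χ.intervalIntegrable_of_Ici le_rfl hs.1)
        (he.continuousOn_χ.intervalIntegrable_of_Ici hs.1 hs.2)]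
    have : ∫ r in s..t, e.χ g r ≤ ∫ r in s..t, (0 : ℝ) := by
      refine intervalIntegral.integral_mono_on_of_le_Ioo hs.2
        (he.continuousOn_χ.intervalIntegrable_of_Ici hs.1 hs.2) intervalIntegrable_const ?_
      intro r hr
      refine mul_nonpos_of_nonneg_of_nonpos g.χ₀_pos.le (sub_nonpos.2 ?_)
      exact (one_le_div g.k_pos).2 (hgt r hr.1 hr.2.le).le
    rw [intervalIntegral.integral_zero] at this
    linarith
  have hS := he.opNorm_S_antitone hψ hs.1 hs.2
  have hzs := he.z_pos hs.1
  rw [S, S, opNorm_smul, opNorm_smul, abs_of_pos (mul_pos (he.z_pos ht) g.f₀_pos),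
    abs_of_pos (mul_pos hzs g.f₀_pos)] at hS
  have h1 : e.z s * g.f₀ * opNorm (e.F t) ≤ e.z s * g.f₀ * opNorm (e.F s) :=
    (mul_le_mul_of_nonneg_right (mul_le_mul_of_nonneg_right hz g.f₀_pos.le)
      (opNorm_nonneg _)).trans hS
  exact absurd ((le_of_mul_le_mul_left h1 (mul_pos hzs g.f₀_pos)).trans hsk) (not_le.2 hk)

lemma IsRun.χ_nonneg (he : e.IsRun g 𝒴 ψ) (hψ : ContinuousOn ψ (Ici 0)) {t : ℝ}
    (ht : 0 ≤ t) : 0 ≤ e.χ g t :=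
  mul_nonneg g.χ₀_pos.le (sub_nonneg.2 ((div_le_one g.k_pos).2 (he.opNorm_F_le hψ ht)))

lemma χ_le (t : ℝ) : e.χ g t ≤ g.χ₀ :=
  mul_le_of_le_one_right g.χ₀_pos.le (sub_le_self _ (div_nonneg (opNorm_nonneg _) g.k_pos.le))

lemma IsRun.z_le_one (he : e.IsRun g 𝒴 ψ) (hψ : ContinuousOn ψ (Ici 0)) {t : ℝ}
    (ht : 0 ≤ t) : e.z t ≤ 1 := by
  rw [he.z_eq ht, Real.exp_le_one_iff, neg_nonpos]
  exact intervalIntegral.integral_nonneg ht fun s hs => he.χ_nonneg hψ hs.1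

/-- Interval excitation makes the inverse of `S` uniformly larger than the identity. -/
lemma IsRun.exists_le_N (he : e.IsRun g 𝒴 ψ) (hψ : ContinuousOn ψ (Ici 0))
    (hie : IntervalExciting ψ) : ∃ T c : ℝ, 0 ≤ T ∧ 1 < c ∧ ∀ t, T ≤ t → ∀ w,
      c * (w ⬝ᵥ w) ≤ w ⬝ᵥ N g e ψ t *ᵥ w := by
  obtain ⟨T, δ, hT, hδ, hpd⟩ := hie
  have hγ : 0 < g.γG / g.f₀ := div_pos g.γG_pos g.f₀_pos
  have hψi := continuousOn_pi.1 hψ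
  -- As `z ≤ 1`, the weight in `N` is at least `γ / f₀`, so `N T ≥ 1 + γ / f₀ ∫ ψ ψᵀ ≥ 1 + γ δ /
  -- f₀`; afterwards the form of `N` does not decrease.
  refine ⟨T, 1 + g.γG / g.f₀ * δ, hT.le, by have := mul_pos hγ hδ; linarith, fun t ht w => ?_⟩
  set P : ℝ → Matrix (Fin 5) (Fin 5) ℝ := fun t => of fun i j => ∫ s in (0 : ℝ)..t, ψ s i * ψ s j
  have hP : HasRate (fun t => w ⬝ᵥ P t *ᵥ w) fun t => (w ⬝ᵥ ψ t) ^ 2 := by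
    refine (HasRate.sum (s := Finset.univ) fun i _ => fun t ht =>
      (HasDerivWithinAt.fun_sum (u := Finset.univ) fun j _ =>
        (hasRate_integral (a := fun t => ψ t i * ψ t j) ((hψi i).mul (hψi j)) t ht).mul_const (w j)).const_mul (w i)).congr_rate
          fun t _ => ?_
    simp only [dotProduct, sq, Finset.mul_sum, Finset.sum_mul]
    rw [Finset.sum_comm]
    exact Finset.sum_congr rfl fun i _ => Finset.sum_congr rfl fun j _ => by ring
  have hN := he.N_quadratic_rate hψ w
  have h1 : w ⬝ᵥ N g e ψ T *ᵥ w ≤ w ⬝ᵥ N g e ψ t *ᵥ w :=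
    hN.monotoneOn (fun s hs => by have := he.z_pos hs; positivity) hT.le (hT.le.trans ht) ht
  have hD : HasRate (fun t => w ⬝ᵥ N g e ψ t *ᵥ w - g.γG / g.f₀ * (w ⬝ᵥ P t *ᵥ w)) fun t =>
      g.γG / g.f₀ / e.z t * (w ⬝ᵥ ψ t) ^ 2 - g.γG / g.f₀ * (w ⬝ᵥ ψ t) ^ 2 :=
    fun s hs => (hN s hs).sub ((hP s hs).const_mul _)
  have h2 := hD.monotoneOn (fun s hs => sub_nonneg.2 (mul_le_mul_of_nonneg_right
    (le_div_self hγ.le (he.z_pos hs) (he.z_le_one hψ hs)) (sq_nonneg _)))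
    self_mem_Ici hT.le hT.le
  have hP0 : P 0 = 0 := by ext i j; simp [P]
  have h3 := hpd.posSemidef.dotProduct_mulVec_nonneg w
  rw [star_trivial, sub_mulVec, dotProduct_sub, smul_mulVec, one_mulVec, dotProduct_smul,
    smul_eq_mul, sub_nonneg] at h3
  have h4 : g.γG / g.f₀ * (δ * (w ⬝ᵥ w)) ≤ g.γG / g.f₀ * (w ⬝ᵥ P T *ᵥ w) :=
    mul_le_mul_of_nonneg_left h3 hγ.le
  simp only [N_init, one_mulVec, hP0, zero_mulVec, dotProduct_zero, mul_zero, sub_zero] at h2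
  linarith

/-- The scalar regressor `Δ` is eventually bounded away from zero. -/
lemma IsRun.exists_le_Δ (he : e.IsRun g 𝒴 ψ) (hψ : ContinuousOn ψ (Ici 0))
    (hie : IntervalExciting ψ) : ∃ T c : ℝ, 0 ≤ T ∧ 0 < c ∧ ∀ t, T ≤ t → c ≤ e.Δ g t := by
  obtain ⟨T, c, hT, hc, hN⟩ := he.exists_le_N hψ hie
  have hc0 : 0 < c := one_pos.trans hc
  have hη : 0 < 1 - 1 / c := sub_pos.2 ((div_lt_one hc0).2 hc)
  -- From `N ≥ c` follows `S ≤ 1 / c`, so the form of `1 - S` is at least `1 - 1 / c`.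
  refine ⟨T, (1 - 1 / c) ^ Fintype.card (Fin 5), hT, pow_pos hη _, fun t ht => ?_⟩
  have ht0 := hT.trans ht
  refine pow_card_le_det ?_ hη.le fun w => ?_
  · rw [mix_eq, IsSymm, transpose_sub, transpose_one, (he.S_isSymm hψ ht0).eq]
  · have := he.S_quadratic_le hψ ht0 hc0 (hN t ht) w
    rw [mix_eq, sub_mulVec, one_mulVec, dotProduct_sub]
    linarith

lemma IsRun.continuousOn_Δ (he : e.IsRun g 𝒴 ψ) : ContinuousOn (e.Δ g) (Ici 0) := by
  have hm : ContinuousOn (e.mix g) (Ici 0) := continuousOn_pi.2 fun i => continuousOn_pi.2 fun j =>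
    continuousOn_const.sub ((he.S_rate i j).continuousOn)
  have hd : Continuous fun A : Matrix (Fin 5) (Fin 5) ℝ => A.det := continuous_id.matrix_det
  exact hd.comp_continuousOn hm

/-! ### Boundedness of the estimator signals. -/

lemma IsRun.bdd_F (he : e.IsRun g 𝒴 ψ) (hψ : ContinuousOn ψ (Ici 0)) (i j : Fin 5) :
    BddSignal fun t => e.F t i j :=
  ⟨g.k, fun _ ht => (abs_apply_le_opNorm _ i j).trans (he.opNorm_F_le hψ ht)⟩

lemma IsRun.bdd_z (he : e.IsRun g 𝒴 ψ) (hψ : ContinuousOn ψ (Ici 0)) : BddSignal e.z :=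
  ⟨1, fun _ ht => by rw [abs_of_pos (he.z_pos ht)]; exact he.z_le_one hψ ht⟩

lemma IsRun.bdd_χ (he : e.IsRun g 𝒴 ψ) (hψ : ContinuousOn ψ (Ici 0)) :
    BddSignal fun t => e.χ g t :=
  ⟨g.χ₀, fun t ht => by rw [abs_of_nonneg (he.χ_nonneg hψ ht)]; exact χ_le t⟩

lemma IsRun.bdd_S (he : e.IsRun g 𝒴 ψ) (hψ : ContinuousOn ψ (Ici 0)) (i j : Fin 5) :
    BddSignal fun t => e.S g t i j :=
  ((he.bdd_z hψ).mul (bddSignal_const g.f₀)).mul (he.bdd_F hψ i j)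

lemma IsRun.bdd_G (he : e.IsRun g 𝒴 ψ) (hψ : ContinuousOn ψ (Ici 0)) {G : Fin 5 → ℝ}
    (hreg : ∀ t, 0 ≤ t → 𝒴 t = ψ t ⬝ᵥ G) (i : Fin 5) : BddSignal fun t => e.G t i := by
  have h : BddSignal fun t => (e.S g t *ᵥ (e.G 0 - G)) i :=
    BddSignal.sum (s := Finset.univ) fun j _ => (he.bdd_S hψ i j).mul (bddSignal_const _)
  refine (h.add (bddSignal_const (G i))).congr fun t ht => ?_
  rw [← he.G_sub_eq hψ hreg ht, Pi.sub_apply, sub_add_cancel]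

lemma IsRun.bdd_Δ (he : e.IsRun g 𝒴 ψ) (hψ : ContinuousOn ψ (Ici 0)) :
    BddSignal fun t => e.Δ g t := by
  have h : ∀ i j, BddSignal fun t => e.mix g t i j := fun i j =>
    (bddSignal_const ((1 : Matrix (Fin 5) (Fin 5) ℝ) i j)).sub (he.bdd_S hψ i j)
  choose C hC using h
  -- The double sum is one bound valid for all entries, as the determinant estimate requires.
  refine ⟨_, fun t ht => det_le (A := e.mix g t) (abv := AbsoluteValue.abs)
    (x := ∑ i, ∑ j, |C i j|) fun i j => ?_⟩
  refine ((hC i j t ht).trans (le_abs_self _)).trans ?_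
  refine (Finset.single_le_sum (f := fun j => |C i j|) (fun _ _ => abs_nonneg _)
    (Finset.mem_univ j)).trans ?_
  exact Finset.single_le_sum (f := fun i => ∑ j, |C i j|)
    (fun _ _ => Finset.sum_nonneg fun _ _ => abs_nonneg _) (Finset.mem_univ i)

/-- The mixed scalar equation `θ̂' = γ Δ (Δ θ - Δ θ̂)`. -/
lemma IsRun.scalar_expToZero (he : e.IsRun g 𝒴 ψ) (hψ : ContinuousOn ψ (Ici 0))
    (hie : IntervalExciting ψ) {γ θ : ℝ} (hγ : 0 < γ) {f : ℝ → ℝ}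
    (hf : HasRate f fun t => γ * e.Δ g t * (e.Δ g t * θ - e.Δ g t * f t)) :
    ExpToZero (fun t => f t - θ) ∧
      ∀ t, 0 ≤ t → ∃ E, 0 ≤ E ∧ E ≤ 1 ∧ f t = E * f 0 + (1 - E) * θ := by
  have hr : HasRate (fun t => f t - θ) fun t => -(γ * e.Δ g t ^ 2) * (f t - θ) :=
    fun t ht => ((hf t ht).sub_const θ).congr_deriv (by ring)
  have hc : ContinuousOn (fun t => γ * e.Δ g t ^ 2) (Ici 0) :=
    continuousOn_const.mul (he.continuousOn_Δ.pow 2)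
  have h0 : ∀ t, 0 ≤ t → 0 ≤ γ * e.Δ g t ^ 2 := fun t _ => by positivity
  constructor
  · obtain ⟨T, c, hT, hc0, hΔ⟩ := he.exists_le_Δ hψ hie
    refine hr.expToZero (c := γ * c ^ 2) hc hT (by positivity) h0 fun t ht => ?_
    have := hΔ t ht
    gcongr
  · intro t ht
    -- The convex weight `E` is the factor by which the error has shrunk; it is at most `1` from the
    -- start, excited or not.
    refine ⟨_, (Real.exp_pos (-∫ s in (0 : ℝ)..t, γ * e.Δ g s ^ 2)).le, ?_, ?_⟩
    · rw [Real.exp_le_one_iff, neg_nonpos]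
      exact intervalIntegral.integral_nonneg ht fun s hs => h0 s hs.1
    · have := hr.eq_mul_exp hc ht
      linarith

end Estimator

/-! ### The dynamic extension -/

lemma Params.a0_pos (p : Params) : 0 < p.a0 :=
  div_pos (mul_pos p.D_pos p.ω₀_pos) (mul_pos two_pos p.H_pos)

section Generator

variable {p : Params} {u : ℝ → Fin 2 → ℝ} {y : ℝ → PMU} {x : ℝ → Fin 4 → ℝ} {v : ℝ → Fin 2 → ℝ}

/-- The input and measurement terms enter both equations identically and cancel. -/
lemma speed_error_rate (hx : IsGenerator p u y x) (hv : IsExtension p u y v) :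
    HasRate (fun t => x t 1 - v t 1) fun t => -p.a0 * (x t 1 - v t 1) :=
  fun t ht => ((hx.dx₂ t ht).sub (hv.dv₂ t ht)).congr_deriv (by ring)

lemma speed_error_expToZero (hx : IsGenerator p u y x) (hv : IsExtension p u y v) :
    ExpToZero fun t => x t 1 - v t 1 :=
  (speed_error_rate hx hv).expToZero (a := fun _ => p.a0) continuousOn_const le_rfl p.a0_pos
    (fun _ _ => p.a0_pos.le) fun _ _ => le_rfl

/-- The quantity `x₁ - v₁ + (x₂ - v₂) / a₀` is conserved, and its initial value is `θ₀` because `v 0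
= 0`. -/
lemma angle_error_eq (hx : IsGenerator p u y x) (hv : IsExtension p u y v) {t : ℝ} (ht : 0 ≤ t) :
    x t 0 - v t 0 - θ₀ p x = -1 / p.a0 * (x t 1 - v t 1) := by
  have ha := p.a0_pos.ne'
  have h : HasRate (fun t => x t 0 - v t 0 + 1 / p.a0 * (x t 1 - v t 1)) fun t =>
      x t 1 - v t 1 + 1 / p.a0 * (-p.a0 * (x t 1 - v t 1)) := fun t ht =>
    ((hx.dx₁ t ht).sub (hv.dv₁ t ht)).add ((speed_error_rate hx hv t ht).const_mul _)
  have h1 := h.eq_initial (fun t _ => by field_simp; ring) ht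
  simp only [hv.init, Pi.zero_apply, sub_zero] at h1
  rw [θ₀]
  linear_combination h1

lemma angle_error_expToZero (hx : IsGenerator p u y x) (hv : IsExtension p u y v) :
    ExpToZero fun t => x t 0 - v t 0 - θ₀ p x :=
  ((speed_error_expToZero hx hv).const_mul _).congr fun _ ht => angle_error_eq hx hv ht

lemma bdd_extension (hx : IsGenerator p u y x) (hxb : ∀ i, BddSignal fun t => x t i)
    (hv : IsExtension p u y v) (i : Fin 2) : BddSignal fun t => v t i := by
  fin_cases i
  · exact (((hxb 0).sub (angle_error_expToZero hx hv).bddSignal).sub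
      (bddSignal_const (θ₀ p x))).congr fun t _ => by
        simp only [Fin.zero_eta]; ring
  · exact ((hxb 1).sub (speed_error_expToZero hx hv).bddSignal).congr fun t _ => by simp

/-! ### The algebraic part of the observer -/

/-- The matrix that maps `(sin (x₁ - y₁), cos (x₁ - y₁))` to `(x₃, x₄)`. -/
noncomputable def statorMatrix (p : Params) (y : PMU) : Matrix (Fin 2) (Fin 2) ℝ :=
  !![-p.R * (y.y₆ / y.y₂) + p.Xd' * (y.y₅ / y.y₂),
      p.R * (y.y₅ / y.y₂) + p.Xd' * (y.y₆ / y.y₂) + y.y₂;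
    p.R * (y.y₅ / y.y₂) + p.Xq' * (y.y₆ / y.y₂) + y.y₂,
      p.R * (y.y₆ / y.y₂) - p.Xq' * (y.y₅ / y.y₂)]

lemma W_eq (p : Params) (v : Fin 2 → ℝ) {y : PMU} (hy : 0 < y.y₂) :
    W p v y = statorMatrix p y * rot (v 0 - y.y₁) := by
  rw [W, ← smul_mul_assoc]
  congr 1
  have := hy.ne'
  ext i j
  fin_cases i <;> fin_cases j <;> simp [statorMatrix] <;> field_simp

lemma rot_mulVec (a b : ℝ) :
    rot a *ᵥ ![Real.sin b, Real.cos b] = ![Real.sin (a + b), Real.cos (a + b)] := by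
  ext i
  fin_cases i <;> simp [rot, mulVec, dotProduct, Fin.sum_univ_two, Real.sin_add, Real.cos_add] <;>
    ring

lemma TerminalRelations.currents_over_voltage {x : Fin 4 → ℝ} {y : PMU}
    (h : TerminalRelations p x y) : ∃ Iq Id : ℝ, y.y₄ ^ 2 = Iq ^ 2 + Id ^ 2 ∧
      y.y₅ / y.y₂ = Real.cos (x 0 - y.y₁) * Iq + Real.sin (x 0 - y.y₁) * Id ∧
      y.y₆ / y.y₂ = Real.cos (x 0 - y.y₁) * Id - Real.sin (x 0 - y.y₁) * Iq ∧
      y.y₂ * Real.cos (x 0 - y.y₁) = x 2 - (p.R * Iq + p.Xd' * Id) ∧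
      y.y₂ * Real.sin (x 0 - y.y₁) = x 3 - (-p.Xq' * Iq + p.R * Id) := by
  obtain ⟨h2, Iq, Id, hq, hd, h4, h5, h6⟩ := h
  refine ⟨Iq, Id, h4, ?_, ?_, hq, hd⟩
  · rw [h5, div_eq_iff h2.ne']
    ring
  · rw [h6, div_eq_iff h2.ne']
    ring

/-- With `c, s` the cosine and sine of `x₁ - y₁`, the ratios `A = y₅ / y₂` and `B = y₆ / y₂` are
rotated currents: `A c - B s = I_q` and `A s + B c = I_d`. The rows are then the stator equations
solved for `x₃` and `x₄`. -/
lemma TerminalRelations.statorMatrix_mulVec {x : Fin 4 → ℝ} {y : PMU}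
    (h : TerminalRelations p x y) :
    statorMatrix p y *ᵥ ![Real.sin (x 0 - y.y₁), Real.cos (x 0 - y.y₁)] = ![x 2, x 3] := by
  obtain ⟨Iq, Id, -, h5, h6, hq, hd⟩ := h.currents_over_voltage
  have hsc := Real.sin_sq_add_cos_sq (x 0 - y.y₁)
  ext i
  fin_cases i <;> simp [statorMatrix, mulVec, dotProduct, Fin.sum_univ_two, h5, h6]
  · linear_combination hq + (p.R * Iq + p.Xd' * Id) * hsc
  · linear_combination hd + (-p.Xq' * Iq + p.R * Id) * hsc

/-- No positive lower bound on `y₂` is needed: `y₅ / y₂` and `y₆ / y₂` are rotated currents, bounded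
through `y₄²`, and `y₂` itself is bounded through the stator equations. -/
lemma bdd_statorMatrix (hx : IsGenerator p u y x) (hxb : ∀ i, BddSignal fun t => x t i)
    (hy : BddSignal fun t => (y t).y₄ ^ 2) (i j : Fin 2) :
    BddSignal fun t => statorMatrix p (y t) i j := by
  have h := fun t ht => (hx.terminal t ht).currents_over_voltage
  choose! Iq Id h4 h5 h6 hq hd using h
  have hI : BddSignal Iq := (hy.add (bddSignal_const 1)).of_le fun t ht => by
    rw [h4 t ht, abs_of_nonneg (a := _ + (1 : ℝ)) (by positivity), ← sq_abs (Iq t)]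
    nlinarith [sq_nonneg (|Iq t| - 1), sq_nonneg (Id t), sq_nonneg (|Iq t|)]
  have hJ : BddSignal Id := (hy.add (bddSignal_const 1)).of_le fun t ht => by
    rw [h4 t ht, abs_of_nonneg (a := _ + (1 : ℝ)) (by positivity), ← sq_abs (Id t)]
    nlinarith [sq_nonneg (|Id t| - 1), sq_nonneg (Iq t), sq_nonneg (|Id t|)]
  have hc := bddSignal_cos fun t => x t 0 - (y t).y₁
  have hs := bddSignal_sin fun t => x t 0 - (y t).y₁
  have hA : BddSignal fun t => (y t).y₅ / (y t).y₂ := ((hc.mul hI).add (hs.mul hJ)).congr h5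
  have hB : BddSignal fun t => (y t).y₆ / (y t).y₂ := ((hc.mul hJ).sub (hs.mul hI)).congr h6
  have hV : BddSignal fun t => (y t).y₂ := by
    refine ((((hxb 2).sub (((bddSignal_const p.R).mul hI).add
      ((bddSignal_const p.Xd').mul hJ))).mul hc).add (((hxb 3).sub
      (((bddSignal_const (-p.Xq')).mul hI).add ((bddSignal_const p.R).mul hJ))).mul hs)).congr
      fun t ht => ?_
    rw [← hq t ht, ← hd t ht]
    linear_combination -(y t).y₂ * Real.sin_sq_add_cos_sq (x t 0 - (y t).y₁)
  fin_cases i <;> fin_cases j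
  · exact ((bddSignal_const (-p.R)).mul hB).add ((bddSignal_const p.Xd').mul hA)
  · exact (((bddSignal_const p.R).mul hA).add ((bddSignal_const p.Xd').mul hB)).add hV
  · exact (((bddSignal_const p.R).mul hA).add ((bddSignal_const p.Xq').mul hB)).add hV
  · exact ((bddSignal_const p.R).mul hB).sub ((bddSignal_const p.Xq').mul hA)

lemma bdd_rot (a : ℝ → ℝ) (i j : Fin 2) : BddSignal fun t => rot (a t) i j := by
  fin_cases i <;> fin_cases j
  · exact bddSignal_cos a
  · exact bddSignal_sin a
  · exact (bddSignal_sin a).neg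
  · exact bddSignal_cos a

lemma bdd_W (hx : IsGenerator p u y x) (hxb : ∀ i, BddSignal fun t => x t i)
    (hy : BddSignal fun t => (y t).y₄ ^ 2) (v : ℝ → Fin 2 → ℝ) (i j : Fin 2) :
    BddSignal fun t => W p (v t) (y t) i j := by
  refine BddSignal.congr (BddSignal.sum (s := Finset.univ) fun k _ =>
    (bdd_statorMatrix hx hxb hy i k).mul (bdd_rot (fun t => v t 0 - (y t).y₁) k j)) fun t ht => ?_
  rw [W_eq p (v t) (hx.terminal t ht).1, mul_apply]

lemma ExpToZero.mulVec_two {A : ℝ → Matrix (Fin 2) (Fin 2) ℝ} {w : ℝ → Fin 2 → ℝ}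
    (hw : ∀ j, ExpToZero fun t => w t j) (hA : ∀ i j, BddSignal fun t => A t i j) (i : Fin 2) :
    ExpToZero fun t => (A t *ᵥ w t) i :=
  (((hw 0).mul_bdd (hA i 0)).add ((hw 1).mul_bdd (hA i 1))).congr fun t _ => by
    simp [mulVec, dotProduct, Fin.sum_univ_two, mul_comm]

/-- The error splits into `W` applied to the parameter error and the stator matrix applied to the
change of sine and cosine when `x₁` is replaced by `v₁ + θ₀`. Both matrices are bounded and both
vectors decay. -/
lemma flux_error_expToZero (hx : IsGenerator p u y x) (hxb : ∀ i, BddSignal fun t => x t i)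
    (hv : IsExtension p u y v) (hy : BddSignal fun t => (y t).y₄ ^ 2) {q₁ q₂ : ℝ → ℝ}
    (h₁ : ExpToZero fun t => q₁ t - Real.sin (θ₀ p x))
    (h₂ : ExpToZero fun t => q₂ t - Real.cos (θ₀ p x)) (i : Fin 2) :
    ExpToZero fun t => (W p (v t) (y t) *ᵥ ![q₁ t, q₂ t]) i - ![x t 2, x t 3] i := by
  have hq : ∀ j, ExpToZero fun t =>
      (![q₁ t, q₂ t] - ![Real.sin (θ₀ p x), Real.cos (θ₀ p x)]) j := by
    intro j
    fin_cases j
    exacts [h₁, h₂]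
  have ha := angle_error_expToZero hx hv
  have hr : ∀ j, ExpToZero fun t =>
      (![Real.sin (v t 0 - (y t).y₁ + θ₀ p x), Real.cos (v t 0 - (y t).y₁ + θ₀ p x)] -
        ![Real.sin (x t 0 - (y t).y₁), Real.cos (x t 0 - (y t).y₁)]) j := by
    have he : ∀ t, |v t 0 - (y t).y₁ + θ₀ p x - (x t 0 - (y t).y₁)|
        = |x t 0 - v t 0 - θ₀ p x| := fun t => by rw [← abs_neg]; congr 1; ring
    intro j
    fin_cases j
    · exact ha.of_le fun t _ => (Real.abs_sin_sub_sin_le _ _).trans (he t).le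
    · exact ha.of_le fun t _ => (Real.abs_cos_sub_cos_le _ _).trans (he t).le
  refine ((ExpToZero.mulVec_two hq (bdd_W hx hxb hy v) i).add
    (ExpToZero.mulVec_two hr (bdd_statorMatrix hx hxb hy) i)).congr fun t ht => ?_
  have hT := hx.terminal t ht
  rw [mulVec_sub, mulVec_sub, hT.statorMatrix_mulVec, ← rot_mulVec, mulVec_mulVec,
    ← W_eq p (v t) hT.1]
  simp only [Pi.sub_apply]
  ring

end Generator

/-! ### The rotor angle -/

lemma abs_arctan_sub_arctan_le (a b : ℝ) : |Real.arctan a - Real.arctan b| ≤ |a - b| := by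
  have h := Convex.norm_image_sub_le_of_norm_deriv_le (f := Real.arctan) (C := 1) (s := univ)
    (fun z _ => Real.differentiable_arctan z) (fun z _ => ?_) convex_univ (mem_univ b) (mem_univ a)
  · simpa using h
  · rw [Real.deriv_arctan, Real.norm_of_nonneg (by positivity)]
    exact (div_le_one (by positivity)).2 (by nlinarith [sq_nonneg z])

lemma ExpToZero.arctan_div_sub {q₁ q₂ : ℝ → ℝ} {c₁ c₂ ε : ℝ} (hε : 0 < ε)
    (h₁ : ExpToZero fun t => q₁ t - c₁) (h₂ : ExpToZero fun t => q₂ t - c₂) (hc : ε ≤ |c₂|)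
    (hq : ∀ t, 0 ≤ t → ε ≤ |q₂ t|) :
    ExpToZero fun t => Real.arctan (q₁ t / q₂ t) - Real.arctan (c₁ / c₂) := by
  have hinv : BddSignal fun t => (q₂ t)⁻¹ := ⟨ε⁻¹, fun t ht => by
    rw [abs_inv]; exact inv_anti₀ hε (hq t ht)⟩
  have hc0 : c₂ ≠ 0 := abs_pos.1 (hε.trans_le hc)
  -- Uses `q₁ / q₂ - c₁ / c₂ = ((q₁ - c₁) - (c₁ / c₂) (q₂ - c₂)) / q₂`.
  refine ((h₁.add (h₂.const_mul (-(c₁ / c₂)))).mul_bdd hinv).of_le fun t ht => ?_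
  have hq0 : q₂ t ≠ 0 := abs_pos.1 (hε.trans_le (hq t ht))
  refine (abs_arctan_sub_arctan_le _ _).trans (le_of_eq ?_)
  congr 1
  field_simp
  ring

/-- The branch of the angle `θ` selected by the arctangent. -/
lemma exists_int_angle_branch {θ σ : ℝ} (hσ : σ = 1 ∨ σ = -1) (h : 0 < σ * Real.cos θ) :
    ∃ m : ℤ, |θ - m * Real.pi| < Real.pi / 2 ∧ (Even m ↔ σ = 1) ∧
      Real.arctan (Real.sin θ / Real.cos θ) = θ - m * Real.pi := by
  have hπ := Real.pi_pos
  -- The branch is the multiple of `π` nearest to `θ`. Equality is excluded below since it would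
  -- force `cos θ = 0`, and positivity of `(-1)ᵐ cos θ` then ties the parity of `m` to `σ`.
  have hle : |θ - round (θ / Real.pi) * Real.pi| ≤ Real.pi / 2 := by
    have h1 := mul_le_mul_of_nonneg_right (abs_sub_round (θ / Real.pi)) hπ.le
    rw [← abs_of_pos hπ, ← abs_mul, abs_of_pos hπ, sub_mul, div_mul_cancel₀ _ hπ.ne'] at h1
    linarith
  set m := round (θ / Real.pi)
  have hcos : Real.cos (θ - m * Real.pi) = (-1) ^ m * Real.cos θ := Real.cos_sub_int_mul_pi θ m
  have hc0 : Real.cos θ ≠ 0 := fun h0 => by simp [h0] at h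
  have hne : Real.cos (θ - m * Real.pi) ≠ 0 := by
    rw [hcos]
    exact mul_ne_zero (zpow_ne_zero _ (by norm_num)) hc0
  have hlt : |θ - m * Real.pi| < Real.pi / 2 := by
    refine lt_of_le_of_ne hle fun heq => hne ?_
    rw [← Real.cos_abs, heq, Real.cos_pi_div_two]
  have hpos : 0 < Real.cos (θ - m * Real.pi) := Real.cos_pos_of_mem_Ioo (abs_lt.1 hlt)
  refine ⟨m, hlt, ?_, ?_⟩
  · rw [hcos] at hpos
    rcases Int.even_or_odd m with hm | hm
    · rw [hm.neg_one_zpow, one_mul] at hpos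
      refine ⟨fun _ => hσ.resolve_right fun h1 => ?_, fun _ => hm⟩
      rw [h1] at h
      linarith
    · rw [hm.neg_one_zpow] at hpos
      refine ⟨fun h1 => absurd h1 (Int.not_even_iff_odd.2 hm), fun h1 => ?_⟩
      rw [h1] at h
      linarith
  · rw [← Real.tan_eq_sin_div_cos, ← Real.tan_sub_int_mul_pi θ m]
    exact Real.arctan_tan (abs_lt.1 hlt).1 (abs_lt.1 hlt).2

end SGObserver

theorem mainTheorem2
    (p : SGObserver.Params) (g : SGObserver.Gains)
    (u : ℝ → Fin 2 → ℝ) (y : ℝ → SGObserver.PMU) (x : ℝ → Fin 4 → ℝ) (v : ℝ → Fin 2 → ℝ)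
    (hx : SGObserver.IsGenerator p u y x)
    (hxb : ∀ i, SGObserver.BddSignal (fun t => x t i))
    (hv : SGObserver.IsExtension p u y v)
    (θ₁ θ₂ : ℝ)
    (hθ₁ : θ₁ = Real.sin (SGObserver.θ₀ p x)) (hθ₂ : θ₂ = Real.cos (SGObserver.θ₀ p x))
    (ψ : ℝ → Fin 5 → ℝ)
    (hreg : ∀ t, 0 ≤ t → (y t).y₄ ^ 2 = ψ t ⬝ᵥ SGObserver.G₀ θ₁ θ₂)
    (hψc : ContinuousOn ψ (Set.Ici 0))
    (hψb : ∀ i, SGObserver.BddSignal (fun t => ψ t i))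
    (hψ : SGObserver.IntervalExciting ψ)
    (e : SGObserver.Estimator)
    (he : e.IsRun g (fun t => (y t).y₄ ^ 2) ψ)
    (θ₂a σ : ℝ) (hθ₂a : 0 < θ₂a) (hσ : σ = 1 ∨ σ = -1)
    (hcos : θ₂a ≤ σ * θ₂) (hinit : θ₂a ≤ σ * e.θ₂ 0) :
    -- (i)
    (SGObserver.ExpToZero (fun t => e.θ₁ t - θ₁) ∧
      SGObserver.ExpToZero (fun t => e.θ₂ t - θ₂)) ∧
    -- (ii)
    (∀ t, 0 ≤ t → θ₂a ≤ σ * e.θ₂ t) ∧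
    -- (iii)
    ((∃ m : ℤ, |SGObserver.θ₀ p x - m * Real.pi| < Real.pi / 2 ∧ (Even m ↔ σ = 1) ∧
        SGObserver.ExpToZero (fun t => e.xhat p v y t 0 + m * Real.pi - x t 0)) ∧
      SGObserver.ExpToZero (fun t => e.xhat p v y t 1 - x t 1) ∧
      SGObserver.ExpToZero (fun t => e.xhat p v y t 2 - x t 2) ∧
      SGObserver.ExpToZero (fun t => e.xhat p v y t 3 - x t 3)) ∧
    -- (iv)
    ((∀ i, SGObserver.BddSignal (fun t => v t i)) ∧
      (∀ i, SGObserver.BddSignal (fun t => e.G t i)) ∧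
      (∀ i j, SGObserver.BddSignal (fun t => e.F t i j)) ∧
      SGObserver.BddSignal e.θ₁ ∧
      SGObserver.BddSignal e.θ₂ ∧
      SGObserver.BddSignal e.z ∧
      SGObserver.BddSignal (fun t => e.χ g t) ∧
      SGObserver.BddSignal (fun t => e.Δ g t) ∧
      (∀ i, SGObserver.BddSignal (fun t => e.Y g t i)) ∧
      (∀ i j, SGObserver.BddSignal (fun t => SGObserver.W p (v t) (y t) i j)) ∧
      (∀ i, SGObserver.BddSignal (fun t => e.xhat p v y t i))) := by
  -- Boundedness of the current is not assumed; it follows from the regression with bounded `ψ`.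
  have hy : SGObserver.BddSignal fun t => (y t).y₄ ^ 2 :=
    SGObserver.BddSignal.congr (SGObserver.BddSignal.sum (s := Finset.univ) fun i _ =>
      (hψb i).mul (SGObserver.bddSignal_const (SGObserver.G₀ θ₁ θ₂ i))) hreg
  have hY : ∀ t, 0 ≤ t → e.Y g t = e.Δ g t • SGObserver.G₀ θ₁ θ₂ :=
    fun t ht => he.Y_eq hψc hreg ht
  obtain ⟨hE₁, -⟩ := he.scalar_expToZero hψc hψ g.γ₁_pos (θ := θ₁)
    (he.dθ₁.congr_rate fun t ht => by rw [hY t ht]; rfl)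
  obtain ⟨hE₂, hconv⟩ := he.scalar_expToZero hψc hψ g.γ₂_pos (θ := θ₂)
    (he.dθ₂.congr_rate fun t ht => by rw [hY t ht]; rfl)
  -- The half-line `θ₂a ≤ σ r` is convex and contains both `θ̂₂(0)` and `θ₂`.
  have hlow : ∀ t, 0 ≤ t → θ₂a ≤ σ * e.θ₂ t := fun t ht => by
    obtain ⟨E, hE0, hE1, hEq⟩ := hconv t ht
    have h1 := mul_le_mul_of_nonneg_left hinit hE0
    have h2 := mul_le_mul_of_nonneg_left hcos (sub_nonneg.2 hE1)
    rw [hEq]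
    linarith
  have habs : ∀ r, θ₂a ≤ σ * r → θ₂a ≤ |r| := fun r hr => by
    rcases hσ with h | h <;> rw [h] at hr
    · exact (hr.trans (one_mul r).le).trans (le_abs_self r)
    · exact (hr.trans (neg_one_mul r).le).trans (neg_le_abs r)
  have hflux := SGObserver.flux_error_expToZero hx hxb hv hy (hθ₁ ▸ hE₁) (hθ₂ ▸ hE₂)
  have hx2 : SGObserver.ExpToZero (fun t => e.xhat p v y t 1 - x t 1) :=
    (SGObserver.speed_error_expToZero hx hv).neg.congr fun t _ => (neg_sub _ _).symm
  have hx3 : SGObserver.ExpToZero (fun t => e.xhat p v y t 2 - x t 2) := hflux 0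
  have hx4 : SGObserver.ExpToZero (fun t => e.xhat p v y t 3 - x t 3) := hflux 1
  obtain ⟨m, hm, hmσ, htan⟩ := SGObserver.exists_int_angle_branch hσ
    (hθ₂a.trans_le (hθ₂ ▸ hcos))
  have hx1 : SGObserver.ExpToZero (fun t => e.xhat p v y t 0 + m * Real.pi - x t 0) := by
    have h1 := SGObserver.ExpToZero.arctan_div_sub hθ₂a hE₁ hE₂ (habs _ hcos)
      fun t ht => habs _ (hlow t ht)
    -- The angle error is the arctangent error relative to `θ₀ - m π`, minus `x₁ - v₁ - θ₀`.
    refine (h1.add (SGObserver.angle_error_expToZero hx hv).neg).congr fun t _ => ?_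
    rw [hθ₁, hθ₂, htan]
    change v t 0 + Real.arctan (e.θ₁ t / e.θ₂ t) + m * Real.pi - x t 0 = _
    ring
  refine ⟨⟨hE₁, hE₂⟩, hlow, ⟨⟨m, hm, hmσ, hx1⟩, hx2, hx3, hx4⟩,
    SGObserver.bdd_extension hx hxb hv, he.bdd_G hψc hreg, he.bdd_F hψc, ?_, ?_,
    he.bdd_z hψc, he.bdd_χ hψc, he.bdd_Δ hψc, fun i => ?_,
    SGObserver.bdd_W hx hxb hy v, fun i => ?_⟩
  · exact (hE₁.bddSignal.add (SGObserver.bddSignal_const θ₁)).congr fun t _ =>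
      (sub_add_cancel _ _).symm
  · exact (hE₂.bddSignal.add (SGObserver.bddSignal_const θ₂)).congr fun t _ =>
      (sub_add_cancel _ _).symm
  · exact ((he.bdd_Δ hψc).mul (SGObserver.bddSignal_const (SGObserver.G₀ θ₁ θ₂ i))).congr
      fun t ht => congrFun (hY t ht) i
  · fin_cases i
    · exact ((hx1.bddSignal.sub (SGObserver.bddSignal_const (m * Real.pi))).add (hxb 0)).congr
        fun t _ => by simp only [Fin.zero_eta]; ring
    · exact (hx2.bddSignal.add (hxb 1)).congr fun t _ => (sub_add_cancel _ _).symm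
    · exact (hx3.bddSignal.add (hxb 2)).congr fun t _ => (sub_add_cancel _ _).symm
    · exact (hx4.bddSignal.add (hxb 3)).congr fun t _ => (sub_add_cancel _ _).symm
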